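/- For $\mathbf{f}:\mathbb{R}\to\mathbb{R}^3$ in $L^1_{\mathrm{loc}}$ with $\int_{\mathbb{R}} \frac{|\mathbf{f}(x)|}{1+x^2}\,dx<\infty$ set $$\|\mathbf{f}\|_{\dot H^{1/2}}^2=\frac1{2\pi}\iint_{\mathbb{R}\times\mathbb{R}}\frac{|\mathbf{f}(x)-\mathbf{f}(y)|^2}{|x-y|^2}\,dx\,dy ,$$ let $\dot H^{1/2}(\mathbb{R};\mathbb{R}^3)$ be the space of those $\mathbf{f}$ for which this is finite, and let $\dot H^{1/2}(\mathbb{R};\mathbb{S}^2)$ be the set of $\mathbf{Q}\in\dot H^{1/2}(\mathbb{R};\mathbb{R}^3)$ with $|\mathbf{Q}(x)|=1$ for a.e. $x\in\mathbb{R}$. For $\mathbf{f},\mathbf{g}\in\dot H^{1/2}(\mathbb{R};\mathbb{R}^3)$ let $$\langle|\nabla|\mathbf{f},\mathbf{g}\rangle=\frac1{2\pi}\iint_{\mathbb{R}\times\mathbb{R}}\frac{(\mathbf{f}(x)-\mathbf{f}(y))\cdot(\mathbf{g}(x)-\mathbf{g}(y))}{|x-y|^2}\,dx\,dy .$$ For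 $v\in\mathbb{R}$, a map $\mathbf{Q}\in\dot H^{1/2}(\mathbb{R};\mathbb{S}^2)$ is a (weak) solution of the profile equation $$\mathbf{Q}\wedge|\nabla|\mathbf{Q}-v\,\partial_x\mathbf{Q}=0 \qquad (\ast)$$ if $\langle|\nabla|\mathbf{Q},\boldsymbol\varphi\wedge\mathbf{Q}\rangle+v\int_{\mathbb{R}}\mathbf{Q}\cdot\boldsymbol\varphi'\,dx=0$ for all $\boldsymbol\varphi\in C_c^\infty(\mathbb{R};\mathbb{R}^3)$, where $\wedge$ is the cross product in $\mathbb{R}^3$. **Theorem (triviality of traveling solitary waves for $|v|\ge1$).** Let $v\in\mathbb{R}$ with $|v|\ge 1$. Then a map $\mathbf{Q}_v:\mathbb{R}\to\mathbb{R}^3$ belongs to $\dot H^{1/2}(\mathbb{R};\mathbb{S}^2)$ and solves $(\ast)$ if and only if there is a constant $\mathbf{p}\in\mathbb{S}^2$ such that $\mathbf{Q}_v(x)=\mathbf{p}$ for a.e. $x\in\mathbb{R}$. -/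

import Mathlib

open MeasureTheory
open scoped ContDiff Matrix

/-- Euclidean three-space. -/
abbrev E3 : Type := EuclideanSpace ℝ (Fin 3)

/-- The cross product `a ∧ b` on Euclidean three-space. -/
noncomputable def wedge (a b : E3) : E3 := WithLp.toLp 2 (a.ofLp ⨯₃ b.ofLp)

/-- The weighted space `L_{1/2}(ℝ; E)` : locally integrable functions such that
`∫ |f(x)| / (1 + x²) dx` is finite. -/
def MemLHalf {E : Type*} [NormedAddCommGroup E] (f : ℝ → E) : Prop :=
  LocallyIntegrable f volume ∧ Integrable (fun x : ℝ => ‖f x‖ / (1 + x ^ 2)) volume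

/-- The double integral `∬ |f(x) - f(y)|² / |x - y|² dx dy` in `[0, ∞]`, that is, `2π` times the
squared `Ḣ^{1/2}` seminorm. -/
noncomputable def gagliardo {E : Type*} [NormedAddCommGroup E] (f : ℝ → E) : ENNReal :=
  ∫⁻ z : ℝ × ℝ, ENNReal.ofReal (‖f z.1 - f z.2‖ ^ 2 / |z.1 - z.2| ^ 2)

/-- The homogeneous Sobolev space `Ḣ^{1/2}(ℝ; E)`. -/
def MemHdotHalf {E : Type*} [NormedAddCommGroup E] (f : ℝ → E) : Prop :=
  MemLHalf f ∧ gagliardo f < ⊤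

/-- The space `Ḣ^{1/2}(ℝ; S²)` (functions are representatives of their a.e. classes). -/
def MemHdotHalfSphere (u : ℝ → E3) : Prop :=
  MemHdotHalf u ∧ ∀ᵐ x : ℝ, ‖u x‖ = 1

/-- The duality pairing `⟨|∇| f, g⟩` for `f, g ∈ Ḣ^{1/2}(ℝ; ℝ³)`,
`(1 / 2π) ∬ (f(x) - f(y)) · (g(x) - g(y)) / |x - y|² dx dy`; the integral converges absolutely
by the Cauchy–Schwarz inequality. -/
noncomputable def absGradPairing (f g : ℝ → E3) : ℝ :=
  1 / (2 * Real.pi) *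
    ∫ z : ℝ × ℝ, inner ℝ (f z.1 - f z.2) (g z.1 - g z.2) / |z.1 - z.2| ^ 2

/-- The distribution `Q ∧ |∇| Q` applied to a vector-valued test function `φ`. Since
`(Q ∧ w) · φ = w · (φ ∧ Q)`, this is `⟨|∇| Q, φ ∧ Q⟩`, where `φ ∧ Q` is again in `Ḣ^{1/2}` when
`Q ∈ Ḣ^{1/2}` is bounded and `φ` is smooth with compact support. -/
noncomputable def wedgeAbsGrad (Q φ : ℝ → E3) : ℝ :=
  absGradPairing Q (fun x => wedge (φ x) (Q x))

/-- The distributional derivative `∂ₓ Q` applied to a vector-valued test function `φ`. -/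
noncomputable def distribDeriv (Q φ : ℝ → E3) : ℝ :=
  - ∫ x : ℝ, inner ℝ (Q x) (deriv φ x)

/-- `Q` is a weak (distributional) solution of `Q ∧ |∇| Q - v ∂ₓ Q = 0` on `ℝ`. -/
def SolvesProfile (v : ℝ) (Q : ℝ → E3) : Prop :=
  ∀ φ : ℝ → E3, ContDiff ℝ ∞ φ → HasCompactSupport φ →
    wedgeAbsGrad Q φ - v * distribDeriv Q φ = 0

open Filter
open scoped Topology FourierTransform Convolution SchwartzMap ENNReal
open ContinuousLinearMap (lsmul)

/-!
Write `A = ∬ |Q(x) - Q(y)|² / |x - y|²` and `B = ∬ |Q(x) ∧ Q(y)|² / |x - y|²`. For a unit vector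
field `Q`, the Hilbert transform `H` satisfies `∫ Q · (HQ)' = A / (2π)`, while
`(Q(x) - Q(y)) · (ψ(x) ∧ Q(x) - ψ(y) ∧ Q(y)) = -(ψ(x) - ψ(y)) · (Q(x) ∧ Q(y))`. Testing the
equation with `ψ = HQ`, whose `Ḣ^{1/2}` seminorm is that of `Q`, and using
`2 |a · b| ≤ |a|² + |b|²` gives `2 |v| A ≤ A + B`. Since `|a ∧ b|² = |a - b|² - |a - b|⁴ / 4` for
unit vectors, `B ≤ A` with equality only if `Q` is constant, and `|v| ≥ 1` forces equality.

The map `HQ` is not an admissible test function, so `H` is replaced by convolution with smooth odd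
kernels of compact support: differences of two conjugate Poisson kernels, whose Fourier transform
is bounded by `1`, multiplied by a cutoff that perturbs this bound by `o(1)`.
-/

/-! ### Convolution operators on `L²` -/

section ConvolutionL2

variable {V : Type*} [NormedAddCommGroup V] [InnerProductSpace ℝ V] [FiniteDimensional ℝ V]
  [MeasurableSpace V] [BorelSpace V]
  {H : Type*} [NormedAddCommGroup H] [InnerProductSpace ℂ H]

theorem eLpNorm_two_fourier_schwartzMap [CompleteSpace H] (f : 𝓢(V, H)) :
    eLpNorm (𝓕 f : 𝓢(V, H)) 2 = eLpNorm f 2 := by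
  have h := SchwartzMap.norm_fourier_toL2_eq f
  rwa [SchwartzMap.norm_toLp, SchwartzMap.norm_toLp,
    ENNReal.toReal_eq_toReal_iff' ((𝓕 f).eLpNorm_lt_top 2 (μ := volume)).ne
      (f.eLpNorm_lt_top 2 (μ := volume)).ne] at h

theorem eLpNorm_two_convolution_schwartzMap_le [CompleteSpace H] (K : 𝓢(V, ℂ)) (f : 𝓢(V, H))
    {M : ℝ} (hM : ∀ ξ, ‖𝓕 K ξ‖ ≤ M) :
    eLpNorm (SchwartzMap.convolution (lsmul ℂ ℂ) K f) 2 ≤ ENNReal.ofReal M * eLpNorm f 2 := by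
  rw [← eLpNorm_two_fourier_schwartzMap, ← eLpNorm_two_fourier_schwartzMap f]
  refine eLpNorm_le_mul_eLpNorm_of_ae_le_mul (Eventually.of_forall fun ξ => ?_) 2
  rw [SchwartzMap.fourier_convolution, SchwartzMap.pairing_apply_apply,
    ContinuousLinearMap.lsmul_apply, norm_smul]
  gcongr
  exact hM ξ

theorem eLpNorm_two_convolution_le_of_contDiff [CompleteSpace H] {K : V → ℂ} (hK : ContDiff ℝ ∞ K)
    (hKc : HasCompactSupport K) {M : ℝ} (hM : ∀ ξ, ‖𝓕 K ξ‖ ≤ M) {f : V → H}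
    (hf : ContDiff ℝ ∞ f) (hfc : HasCompactSupport f) :
    eLpNorm (K ⋆[lsmul ℂ ℂ] f) 2 ≤ ENNReal.ofReal M * eLpNorm f 2 := by
  have h := eLpNorm_two_convolution_schwartzMap_le (hKc.toSchwartzMap hK) (hfc.toSchwartzMap hf)
    (M := M) fun ξ => by rw [SchwartzMap.fourier_coe]; exact hM ξ
  have h_eq : K ⋆[lsmul ℂ ℂ] f =
      SchwartzMap.convolution (lsmul ℂ ℂ) (hKc.toSchwartzMap hK) (hfc.toSchwartzMap hf) := by
    ext x
    rw [SchwartzMap.convolution_apply]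
    rfl
  rw [h_eq]
  exact h

theorem edist_convolution_le {K : V → ℂ} {f g : V → H} (hK : MemLp K 2)
    (hf : MemLp f 2) (hg : MemLp g 2) (x : V) :
    edist ((K ⋆[lsmul ℂ ℂ] g) x) ((K ⋆[lsmul ℂ ℂ] f) x) ≤ eLpNorm K 2 * eLpNorm (f - g) 2 := by
  have reflect : MeasurePreserving (fun t : V => x - t) volume volume :=
    Measure.measurePreserving_sub_left volume x
  have integrable_smul {u : V → H} (hu : MemLp u 2) : Integrable fun t => K t • u (x - t) :=
    memLp_one_iff_integrable.1 ((hu.comp_measurePreserving reflect).smul hK)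
  have hsub := hf.aestronglyMeasurable.sub hg.aestronglyMeasurable
  calc edist ((K ⋆[lsmul ℂ ℂ] g) x) ((K ⋆[lsmul ℂ ℂ] f) x)
      = ‖∫ t, (K • ((f - g) ∘ fun t => x - t)) t‖ₑ := by
        rw [edist_comm, edist_eq_enorm_sub, convolution_def, convolution_def]
        simp only [ContinuousLinearMap.lsmul_apply]
        rw [← integral_sub (integrable_smul hf) (integrable_smul hg)]
        simp only [← smul_sub]
        rfl
    _ ≤ eLpNorm (K • ((f - g) ∘ fun t => x - t)) 1 volume := by
        rw [eLpNorm_one_eq_lintegral_enorm]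
        exact enorm_integral_le_lintegral_enorm _
    _ ≤ eLpNorm K 2 volume * eLpNorm ((f - g) ∘ fun t => x - t) 2 volume :=
        eLpNorm_smul_le_mul_eLpNorm (hsub.comp_measurePreserving reflect) hK.aestronglyMeasurable
    _ = eLpNorm K 2 volume * eLpNorm (f - g) 2 volume := by
        rw [eLpNorm_comp_measurePreserving hsub reflect]

theorem exists_seq_contDiff_tendsto_eLpNorm_sub {F : Type*} [NormedAddCommGroup F]
    [NormedSpace ℝ F] {p : ℝ≥0∞} (hp : p ≠ ⊤) (hp1 : 1 ≤ p) {f : V → F} (hf : MemLp f p) :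
    ∃ g : ℕ → V → F, (∀ n, HasCompactSupport (g n)) ∧ (∀ n, ContDiff ℝ ∞ (g n)) ∧
      Tendsto (fun n => eLpNorm (f - g n) p) atTop (𝓝 0) := by
  choose g hgc hg hfg using fun n : ℕ =>
    hf.exist_eLpNorm_sub_le hp hp1 (Nat.one_div_pos_of_nat (α := ℝ) (n := n))
  refine ⟨g, hgc, hg, tendsto_of_tendsto_of_tendsto_of_le_of_le tendsto_const_nhds ?_
    (fun _ => bot_le) hfg⟩
  simpa using ENNReal.tendsto_ofReal (tendsto_one_div_add_atTop_nhds_zero_nat (𝕜 := ℝ))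

theorem eLpNorm_two_convolution_le [CompleteSpace H] {K : V → ℂ} (hK : ContDiff ℝ ∞ K)
    (hKc : HasCompactSupport K) {M : ℝ} (hM : ∀ ξ, ‖𝓕 K ξ‖ ≤ M) {f : V → H} (hf : MemLp f 2) :
    eLpNorm (K ⋆[lsmul ℂ ℂ] f) 2 ≤ ENNReal.ofReal M * eLpNorm f 2 := by
  obtain ⟨g, hgc, hg, hlim⟩ := exists_seq_contDiff_tendsto_eLpNorm_sub (by simp) (by simp) hf
  have hK2 : MemLp K 2 := hK.continuous.memLp_of_hasCompactSupport hKc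
  have hg2 (n : ℕ) : MemLp (g n) 2 := (hg n).continuous.memLp_of_hasCompactSupport (hgc n)
  have pointwise (x : V) :
      Tendsto (fun n => (K ⋆[lsmul ℂ ℂ] g n) x) atTop (𝓝 ((K ⋆[lsmul ℂ ℂ] f) x)) := by
    rw [tendsto_iff_edist_tendsto_0]
    refine tendsto_of_tendsto_of_tendsto_of_le_of_le tendsto_const_nhds ?_ (fun _ => bot_le)
      fun n => edist_convolution_le hK2 hf (hg2 n) x
    simpa using ENNReal.Tendsto.const_mul hlim (Or.inr hK2.eLpNorm_ne_top)
  have bound (n : ℕ) : eLpNorm (K ⋆[lsmul ℂ ℂ] g n) 2 ≤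
      ENNReal.ofReal M * (eLpNorm f 2 + eLpNorm (f - g n) 2) := by
    refine (eLpNorm_two_convolution_le_of_contDiff hK hKc hM (hg n) (hgc n)).trans ?_
    gcongr
    simpa using eLpNorm_sub_le hf.aestronglyMeasurable (hf.sub (hg2 n)).aestronglyMeasurable
      one_le_two
  have bound_lim : Tendsto (fun n => ENNReal.ofReal M * (eLpNorm f 2 + eLpNorm (f - g n) 2))
      atTop (𝓝 (ENNReal.ofReal M * eLpNorm f 2)) := by
    simpa using ENNReal.Tendsto.const_mul (tendsto_const_nhds.add hlim)
      (Or.inr ENNReal.ofReal_ne_top)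
  calc eLpNorm (K ⋆[lsmul ℂ ℂ] f) 2 volume
      ≤ liminf (fun n => eLpNorm (K ⋆[lsmul ℂ ℂ] g n) 2 volume) atTop :=
        Lp.eLpNorm_lim_le_liminf_eLpNorm (fun n => (hKc.continuous_convolution_left _ hK.continuous
          (hg n).continuous.locallyIntegrable).aestronglyMeasurable) _
          (Eventually.of_forall pointwise)
    _ ≤ liminf (fun n => ENNReal.ofReal M *
          (eLpNorm f 2 volume + eLpNorm (f - g n) 2 volume)) atTop :=
        liminf_le_liminf (Eventually.of_forall bound)
    _ = ENNReal.ofReal M * eLpNorm f 2 volume := bound_lim.liminf_eq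

/-- The coordinatewise inclusion of `ℝ^ι` in `ℂ^ι`; it transfers Plancherel's theorem to functions
with values in a real Euclidean space. -/
noncomputable def complexify (ι : Type*) [Fintype ι] :
    EuclideanSpace ℝ ι →ₗᵢ[ℝ] EuclideanSpace ℂ ι where
  toFun x := WithLp.toLp 2 fun i => (x i : ℂ)
  map_add' x y := by ext i; simp
  map_smul' c x := by ext i; simp
  norm_map' x := by simp [EuclideanSpace.norm_eq]

theorem complexify_convolution {ι : Type*} [Fintype ι] (K : V → ℝ) (f : V → EuclideanSpace ℝ ι) :
    ((fun t => (K t : ℂ)) ⋆[lsmul ℂ ℂ] fun x => complexify ι (f x)) =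
      fun x => complexify ι ((K ⋆[lsmul ℝ ℝ] f) x) := by
  ext1 x
  rw [convolution_def, convolution_def]
  refine Eq.trans ?_ ((complexify ι).integral_comp_comm fun t => lsmul ℝ ℝ (K t) (f (x - t)))
  refine integral_congr_ae (Eventually.of_forall fun t => ?_)
  simp only [ContinuousLinearMap.lsmul_apply, map_smul]
  exact (RCLike.real_smul_eq_coe_smul (K := ℂ) (K t) _).symm

theorem eLpNorm_two_real_convolution_le {ι : Type*} [Fintype ι] {K : V → ℝ}
    (hK : ContDiff ℝ ∞ K) (hKc : HasCompactSupport K) {M : ℝ}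
    (hM : ∀ ξ, ‖𝓕 (fun t => (K t : ℂ)) ξ‖ ≤ M) {f : V → EuclideanSpace ℝ ι} (hf : MemLp f 2) :
    eLpNorm (K ⋆[lsmul ℝ ℝ] f) 2 ≤ ENNReal.ofReal M * eLpNorm f 2 := by
  have eLpNorm_complexify (u : V → EuclideanSpace ℝ ι) :
      eLpNorm (fun x => complexify ι (u x)) 2 = eLpNorm u 2 :=
    eLpNorm_congr_norm_ae (Eventually.of_forall fun x => (complexify ι).norm_map _)
  have h := eLpNorm_two_convolution_le (K := fun t => (K t : ℂ))
    (Complex.ofRealCLM.contDiff.comp hK) (hKc.comp_left Complex.ofReal_zero) hM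
    ((complexify ι).toContinuousLinearMap.comp_memLp' hf)
  rw [← eLpNorm_complexify, ← eLpNorm_complexify f, ← complexify_convolution]
  exact h

end ConvolutionL2

/-! ### The truncated Hilbert kernel -/

section HilbertKernel

/-- The conjugate Poisson kernel at height `s`, which tends to the Hilbert kernel `1 / (π h)` as
`s → 0`. -/
noncomputable def conjPoisson (s h : ℝ) : ℝ := Real.pi⁻¹ * (h / (h ^ 2 + s ^ 2))

/-- The Fourier transform `-i sgn(ξ) exp(-2π s |ξ|)` of the conjugate Poisson kernel at height `s`,
with the value at `ξ = 0` chosen so that it is left continuous. -/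
noncomputable def conjPoissonSymbol (s ξ : ℝ) : ℂ :=
  (if 0 < ξ then -Complex.I else Complex.I) * Real.exp (-(2 * Real.pi * s * |ξ|))

theorem cexp_smul_conjPoissonSymbol_of_pos (s x : ℝ) {ξ : ℝ} (hξ : 0 < ξ) :
    Complex.exp ((2 * Real.pi * inner ℝ ξ x : ℝ) * Complex.I) • conjPoissonSymbol s ξ =
      -Complex.I * Complex.exp (-(2 * Real.pi * (s - x * Complex.I)) * ξ) := by
  rw [conjPoissonSymbol, if_pos hξ, abs_of_pos hξ, smul_eq_mul, Complex.ofReal_exp, mul_left_comm,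
    ← Complex.exp_add]
  congr 2
  simp only [RCLike.inner_apply, conj_trivial]
  push_cast
  ring

theorem cexp_smul_conjPoissonSymbol_of_nonpos (s x : ℝ) {ξ : ℝ} (hξ : ξ ≤ 0) :
    Complex.exp ((2 * Real.pi * inner ℝ ξ x : ℝ) * Complex.I) • conjPoissonSymbol s ξ =
      Complex.I * Complex.exp (2 * Real.pi * (s + x * Complex.I) * ξ) := by
  rw [conjPoissonSymbol, if_neg hξ.not_gt, abs_of_nonpos hξ, smul_eq_mul, Complex.ofReal_exp,
    mul_left_comm, ← Complex.exp_add]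
  congr 2
  simp only [RCLike.inner_apply, conj_trivial]
  push_cast
  ring

variable {s : ℝ}

theorem integrable_cexp_smul_conjPoissonSymbol (hs : 0 < s) (x : ℝ) : Integrable fun ξ : ℝ =>
    Complex.exp ((2 * Real.pi * inner ℝ ξ x : ℝ) * Complex.I) • conjPoissonSymbol s ξ := by
  have hre : 0 < 2 * Real.pi * s := by positivity
  rw [← integrableOn_univ, ← Set.Iic_union_Ioi (a := (0 : ℝ)), integrableOn_union]
  constructor
  · refine IntegrableOn.congr_fun ?_
      (fun ξ hξ => (cexp_smul_conjPoissonSymbol_of_nonpos s x hξ).symm) measurableSet_Iic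
    exact (integrableOn_exp_mul_complex_Iic (by simpa using hre) 0).const_mul _
  · refine IntegrableOn.congr_fun ?_
      (fun ξ hξ => (cexp_smul_conjPoissonSymbol_of_pos s x hξ).symm) measurableSet_Ioi
    exact (integrableOn_exp_mul_complex_Ioi (by simpa using hre) 0).const_mul _

theorem integrable_conjPoissonSymbol (hs : 0 < s) : Integrable (conjPoissonSymbol s) := by
  simpa using integrable_cexp_smul_conjPoissonSymbol hs 0

theorem fourierInv_conjPoissonSymbol (hs : 0 < s) (x : ℝ) :
    𝓕⁻ (conjPoissonSymbol s) x = conjPoisson s x := by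
  have hre : 0 < 2 * Real.pi * s := by positivity
  have hpi : (Real.pi : ℂ) ≠ 0 := Complex.ofReal_ne_zero.2 Real.pi_ne_zero
  have hadd : (s + x * Complex.I : ℂ) ≠ 0 := fun h => hs.ne' (by simpa using congrArg Complex.re h)
  have hsub : (s - x * Complex.I : ℂ) ≠ 0 := fun h => hs.ne' (by simpa using congrArg Complex.re h)
  have hprod : (x ^ 2 + s ^ 2 : ℂ) = (s + x * Complex.I) * (s - x * Complex.I) := by
    linear_combination ((x : ℂ) ^ 2) * Complex.I_sq
  have partial_fractions {w w' : ℂ} (hw : w ≠ 0) (hw' : w' ≠ 0)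
      (hww' : w - w' = 2 * x * Complex.I) :
      Complex.I * (1 / (2 * Real.pi * w)) + -Complex.I * (1 / (2 * Real.pi * w')) =
        (Real.pi : ℂ)⁻¹ * (x / (w * w')) := by
    field_simp
    linear_combination (-Complex.I) * hww' - 2 * (x : ℂ) * Complex.I_sq
  have integral_Iic : ∫ ξ in Set.Iic (0 : ℝ), Complex.exp (2 * Real.pi * (s + x * Complex.I) * ξ) =
      1 / (2 * Real.pi * (s + x * Complex.I)) := by
    rw [integral_exp_mul_complex_Iic (by simpa using hre)]
    simp
  have integral_Ioi :
      ∫ ξ in Set.Ioi (0 : ℝ), Complex.exp (-(2 * Real.pi * (s - x * Complex.I)) * ξ) =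
        1 / (2 * Real.pi * (s - x * Complex.I)) := by
    rw [integral_exp_mul_complex_Ioi (by simpa using hre)]
    simp
  have hint := integrable_cexp_smul_conjPoissonSymbol hs x
  rw [Real.fourierInv_eq', ← intervalIntegral.integral_Iic_add_Ioi (b := 0) hint.integrableOn
      hint.integrableOn,
    setIntegral_congr_fun measurableSet_Iic fun ξ => cexp_smul_conjPoissonSymbol_of_nonpos s x,
    setIntegral_congr_fun measurableSet_Ioi fun ξ => cexp_smul_conjPoissonSymbol_of_pos s x,
    integral_const_mul, integral_const_mul, integral_Iic, integral_Ioi, conjPoisson]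
  push_cast
  rw [hprod]
  exact partial_fractions hadd hsub (by ring)

theorem contDiff_conjPoisson (hs : 0 < s) : ContDiff ℝ ∞ (conjPoisson s) :=
  contDiff_const.mul (contDiff_id.div (by fun_prop) fun x => by positivity)

theorem abs_conjPoisson_mul_abs_le (s h : ℝ) : |conjPoisson s h| * |h| ≤ Real.pi⁻¹ := by
  have h_le : h ^ 2 / (h ^ 2 + s ^ 2) ≤ 1 :=
    div_le_one_of_le₀ (by linarith [sq_nonneg s]) (by positivity)
  calc |conjPoisson s h| * |h| = Real.pi⁻¹ * (h ^ 2 / (h ^ 2 + s ^ 2)) := by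
        rw [conjPoisson, abs_mul, abs_div, abs_of_nonneg (a := h ^ 2 + s ^ 2) (by positivity),
          abs_of_pos (inv_pos.2 Real.pi_pos), mul_assoc, div_mul_eq_mul_div, abs_mul_abs_self, sq]
    _ ≤ Real.pi⁻¹ := mul_le_of_le_one_right (by positivity) h_le

theorem hasDerivAt_conjPoisson (hs : 0 < s) (h : ℝ) :
    HasDerivAt (conjPoisson s) (Real.pi⁻¹ * ((s ^ 2 - h ^ 2) / (h ^ 2 + s ^ 2) ^ 2)) h := by
  have hd := ((hasDerivAt_id' h).fun_div ((hasDerivAt_pow 2 h).add_const (s ^ 2))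
    (by positivity)).const_mul Real.pi⁻¹
  refine hd.congr_deriv ?_
  ring

theorem abs_deriv_conjPoisson_le (hs : 0 < s) (h : ℝ) :
    |deriv (conjPoisson s) h| ≤ Real.pi⁻¹ * (h ^ 2 + s ^ 2)⁻¹ := by
  rw [(hasDerivAt_conjPoisson hs h).deriv, abs_mul, abs_of_pos (inv_pos.2 Real.pi_pos), abs_div,
    abs_of_nonneg (sq_nonneg (h ^ 2 + s ^ 2))]
  have h_abs : |s ^ 2 - h ^ 2| ≤ h ^ 2 + s ^ 2 :=
    abs_le.2 ⟨by linarith [sq_nonneg s], by linarith [sq_nonneg h]⟩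
  gcongr
  calc |s ^ 2 - h ^ 2| / (h ^ 2 + s ^ 2) ^ 2 ≤ (h ^ 2 + s ^ 2) / (h ^ 2 + s ^ 2) ^ 2 := by gcongr
    _ = (h ^ 2 + s ^ 2)⁻¹ := by field_simp

theorem abs_deriv_conjPoisson_mul_sq_le (hs : 0 < s) (h : ℝ) :
    |deriv (conjPoisson s) h| * h ^ 2 ≤ Real.pi⁻¹ := by
  calc |deriv (conjPoisson s) h| * h ^ 2 ≤ Real.pi⁻¹ * (h ^ 2 + s ^ 2)⁻¹ * h ^ 2 := by
        gcongr
        exact abs_deriv_conjPoisson_le hs h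
    _ ≤ Real.pi⁻¹ := by
        rw [mul_assoc]
        refine mul_le_of_le_one_right (by positivity) ((inv_mul_le_one₀ (by positivity)).2 ?_)
        linarith [sq_nonneg s]

theorem tendsto_deriv_conjPoisson_nhdsGT_zero {h : ℝ} (hh : h ≠ 0) :
    Tendsto (fun s => deriv (conjPoisson s) h) (𝓝[>] 0) (𝓝 (-(Real.pi⁻¹ * (h ^ 2)⁻¹))) := by
  have hcont : ContinuousAt (fun s => Real.pi⁻¹ * ((s ^ 2 - h ^ 2) / (h ^ 2 + s ^ 2) ^ 2)) 0 :=
    continuousAt_const.mul (ContinuousAt.div (by fun_prop) (by fun_prop) (by positivity))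
  have hlim := hcont.tendsto.mono_left (nhdsWithin_le_nhds (s := Set.Ioi 0))
  have hval : Real.pi⁻¹ * ((0 ^ 2 - h ^ 2) / (h ^ 2 + 0 ^ 2) ^ 2) = -(Real.pi⁻¹ * (h ^ 2)⁻¹) := by
    field_simp
    ring
  rw [hval] at hlim
  refine hlim.congr' ?_
  filter_upwards [self_mem_nhdsWithin] with s hs
  exact (hasDerivAt_conjPoisson hs h).deriv.symm

theorem tendsto_deriv_conjPoisson_atTop (h : ℝ) :
    Tendsto (fun s => deriv (conjPoisson s) h) atTop (𝓝 0) := by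
  have hlim : Tendsto (fun s : ℝ => Real.pi⁻¹ * (h ^ 2 + s ^ 2)⁻¹) atTop (𝓝 0) := by
    simpa using (tendsto_inv_atTop_zero.comp
      (tendsto_atTop_add_const_left _ (h ^ 2) (tendsto_pow_atTop two_ne_zero))).const_mul Real.pi⁻¹
  refine squeeze_zero_norm' ?_ hlim
  filter_upwards [eventually_gt_atTop 0] with s hs
  exact abs_deriv_conjPoisson_le hs h

/-- The difference of the conjugate Poisson kernels at heights `r⁻¹` and `r`: an odd, smooth and
integrable truncation, for `r → ∞`, of the Hilbert kernel `1 / (π h)` near zero and at infinity. -/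
noncomputable def truncHilbert (r h : ℝ) : ℝ := conjPoisson r⁻¹ h - conjPoisson r h

variable {r : ℝ}

theorem truncHilbert_neg (r h : ℝ) : truncHilbert r (-h) = -truncHilbert r h := by
  simp only [truncHilbert, conjPoisson, neg_sq, neg_div, mul_neg]
  ring

theorem contDiff_truncHilbert (hr : 0 < r) : ContDiff ℝ ∞ (truncHilbert r) :=
  (contDiff_conjPoisson (inv_pos.2 hr)).sub (contDiff_conjPoisson hr)

theorem deriv_truncHilbert (hr : 0 < r) (h : ℝ) :
    deriv (truncHilbert r) h = deriv (conjPoisson r⁻¹) h - deriv (conjPoisson r) h :=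
  deriv_fun_sub (hasDerivAt_conjPoisson (inv_pos.2 hr) h).differentiableAt
    (hasDerivAt_conjPoisson hr h).differentiableAt

theorem abs_truncHilbert_mul_abs_le (r h : ℝ) : |truncHilbert r h| * |h| ≤ 2 * Real.pi⁻¹ := by
  calc |truncHilbert r h| * |h| ≤ (|conjPoisson r⁻¹ h| + |conjPoisson r h|) * |h| := by
        gcongr
        exact abs_sub _ _
    _ ≤ 2 * Real.pi⁻¹ := by
        linarith [abs_conjPoisson_mul_abs_le r⁻¹ h, abs_conjPoisson_mul_abs_le r h]

theorem abs_deriv_truncHilbert_mul_sq_le (hr : 0 < r) (h : ℝ) :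
    |deriv (truncHilbert r) h| * h ^ 2 ≤ 2 * Real.pi⁻¹ := by
  rw [deriv_truncHilbert hr]
  calc |deriv (conjPoisson r⁻¹) h - deriv (conjPoisson r) h| * h ^ 2
      ≤ (|deriv (conjPoisson r⁻¹) h| + |deriv (conjPoisson r) h|) * h ^ 2 := by
        gcongr
        exact abs_sub _ _
    _ ≤ 2 * Real.pi⁻¹ := by
        linarith [abs_deriv_conjPoisson_mul_sq_le (inv_pos.2 hr) h,
          abs_deriv_conjPoisson_mul_sq_le hr h]

theorem tendsto_deriv_truncHilbert {h : ℝ} (hh : h ≠ 0) :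
    Tendsto (fun r => deriv (truncHilbert r) h) atTop (𝓝 (-(Real.pi⁻¹ * (h ^ 2)⁻¹))) := by
  have hlim := ((tendsto_deriv_conjPoisson_nhdsGT_zero hh).comp
    tendsto_inv_atTop_nhdsGT_zero).sub (tendsto_deriv_conjPoisson_atTop h)
  rw [sub_zero] at hlim
  refine hlim.congr' ?_
  filter_upwards [eventually_gt_atTop 0] with r hr
  exact (deriv_truncHilbert hr h).symm

theorem abs_truncHilbert_le (hr : 1 ≤ r) (h : ℝ) :
    |truncHilbert r h| ≤ r ^ 3 * (1 + h ^ 2)⁻¹ := by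
  have hr0 : 0 < r := by linarith
  have hpi : Real.pi⁻¹ ≤ 1 := inv_le_one_of_one_le₀ (by linarith [Real.pi_gt_three])
  have hr_inv : r⁻¹ ^ 2 ≤ r ^ 2 :=
    pow_le_pow_left₀ (by positivity) ((inv_le_one_of_one_le₀ hr).trans hr) 2
  have h_eq : truncHilbert r h = Real.pi⁻¹ *
      (h / (h ^ 2 + r⁻¹ ^ 2) * ((r ^ 2 - r⁻¹ ^ 2) / (h ^ 2 + r ^ 2))) := by
    have h1 : h ^ 2 + r⁻¹ ^ 2 ≠ 0 := by positivity
    have h2 : h ^ 2 + r ^ 2 ≠ 0 := by positivity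
    rw [truncHilbert, conjPoisson, conjPoisson]
    generalize r⁻¹ = t at *
    field_simp
    ring
  have near_zero : |h| / (h ^ 2 + r⁻¹ ^ 2) ≤ r := by
    rw [div_le_iff₀ (by positivity), ← sq_abs h]
    have hrr : r * r⁻¹ = 1 := mul_inv_cancel₀ hr0.ne'
    nlinarith [sq_nonneg (|h| - r⁻¹), abs_nonneg h, mul_nonneg hr0.le (sq_nonneg (|h| - r⁻¹))]
  have at_infinity : (r ^ 2 - r⁻¹ ^ 2) / (h ^ 2 + r ^ 2) ≤ r ^ 2 * (1 + h ^ 2)⁻¹ := by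
    rw [← div_eq_mul_inv, add_comm 1]
    exact div_le_div₀ (by positivity) (by linarith [sq_nonneg r⁻¹]) (by positivity) (by nlinarith)
  rw [h_eq, abs_mul, abs_mul, abs_div, abs_div, abs_of_pos (inv_pos.2 Real.pi_pos),
    abs_of_nonneg (sub_nonneg.2 hr_inv), abs_of_pos (a := h ^ 2 + r⁻¹ ^ 2) (by positivity),
    abs_of_pos (a := h ^ 2 + r ^ 2) (by positivity)]
  calc Real.pi⁻¹ * (|h| / (h ^ 2 + r⁻¹ ^ 2) * ((r ^ 2 - r⁻¹ ^ 2) / (h ^ 2 + r ^ 2)))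
      ≤ 1 * (r * (r ^ 2 * (1 + h ^ 2)⁻¹)) := by
        have := sub_nonneg.2 hr_inv
        gcongr
    _ = r ^ 3 * (1 + h ^ 2)⁻¹ := by ring

theorem integrable_truncHilbert (hr : 1 ≤ r) : Integrable (truncHilbert r) :=
  (integrable_inv_one_add_sq.const_mul (r ^ 3)).mono'
    (contDiff_truncHilbert (by positivity)).continuous.aestronglyMeasurable
    (Eventually.of_forall (abs_truncHilbert_le hr))

theorem norm_conjPoissonSymbol_sub_le {a b : ℝ} (ha : 0 ≤ a) (hb : 0 ≤ b) (ξ : ℝ) :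
    ‖conjPoissonSymbol a ξ - conjPoissonSymbol b ξ‖ ≤ 1 := by
  have exp_le {c : ℝ} (hc : 0 ≤ c) : Real.exp (-(2 * Real.pi * c * |ξ|)) ≤ 1 :=
    Real.exp_le_one_iff.2 (neg_nonpos.2 (by positivity))
  have norm_unit : ‖if 0 < ξ then -Complex.I else Complex.I‖ = 1 := by split_ifs <;> simp
  rw [conjPoissonSymbol, conjPoissonSymbol, ← mul_sub, norm_mul, norm_unit, one_mul,
    ← Complex.ofReal_sub, Complex.norm_real, Real.norm_eq_abs]
  exact abs_sub_le_of_nonneg_of_le (Real.exp_nonneg _) (exp_le ha) (Real.exp_nonneg _) (exp_le hb)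

theorem continuous_conjPoissonSymbol_sub (a b : ℝ) :
    Continuous fun ξ => conjPoissonSymbol a ξ - conjPoissonSymbol b ξ := by
  have h_eq : (fun ξ => conjPoissonSymbol a ξ - conjPoissonSymbol b ξ) = fun ξ =>
      if 0 < ξ then -Complex.I * (Real.exp (-(2 * Real.pi * a * |ξ|)) -
          Real.exp (-(2 * Real.pi * b * |ξ|)) : ℂ)
        else Complex.I * (Real.exp (-(2 * Real.pi * a * |ξ|)) -
          Real.exp (-(2 * Real.pi * b * |ξ|)) : ℂ) := by
    ext ξ
    simp only [conjPoissonSymbol]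
    split_ifs <;> ring
  rw [h_eq]
  refine Continuous.if (fun ξ hξ => ?_) (by fun_prop) (by fun_prop)
  have hξ0 : ξ = 0 := by simpa [frontier_Ioi] using (show ξ ∈ frontier (Set.Ioi (0 : ℝ)) from hξ)
  simp [hξ0]

theorem fourierInv_conjPoissonSymbol_sub (hr : 0 < r) :
    𝓕⁻ (fun ξ => conjPoissonSymbol r⁻¹ ξ - conjPoissonSymbol r ξ) =
      fun h => (truncHilbert r h : ℂ) := by
  ext h
  rw [truncHilbert, Complex.ofReal_sub, ← fourierInv_conjPoissonSymbol (inv_pos.2 hr),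
    ← fourierInv_conjPoissonSymbol hr]
  simp only [Real.fourierInv_eq', smul_sub]
  exact integral_sub (integrable_cexp_smul_conjPoissonSymbol (inv_pos.2 hr) h)
    (integrable_cexp_smul_conjPoissonSymbol hr h)

theorem fourier_truncHilbert (hr : 1 ≤ r) :
    𝓕 (fun h => (truncHilbert r h : ℂ)) =
      fun ξ => conjPoissonSymbol r⁻¹ ξ - conjPoissonSymbol r ξ := by
  have hr0 : 0 < r := by linarith
  rw [← fourierInv_conjPoissonSymbol_sub hr0]
  refine (continuous_conjPoissonSymbol_sub _ _).fourier_fourierInv_eq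
    ((integrable_conjPoissonSymbol (inv_pos.2 hr0)).sub (integrable_conjPoissonSymbol hr0)) ?_
  have h_eq : 𝓕 (fun ξ => conjPoissonSymbol r⁻¹ ξ - conjPoissonSymbol r ξ) =
      fun h => ((truncHilbert r (-h) : ℝ) : ℂ) := by
    ext h
    rw [← congrFun (fourierInv_conjPoissonSymbol_sub hr0) (-h), Real.fourierInv_eq_fourier_neg,
      neg_neg]
  rw [h_eq]
  exact (integrable_truncHilbert hr).comp_neg.ofReal

theorem norm_fourier_truncHilbert_le (hr : 1 ≤ r) (ξ : ℝ) :
    ‖𝓕 (fun h => (truncHilbert r h : ℂ)) ξ‖ ≤ 1 := by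
  rw [fourier_truncHilbert hr]
  exact norm_conjPoissonSymbol_sub_le (by positivity) (by positivity) ξ

end HilbertKernel

/-! ### Cutoff functions -/

section Cutoff

/-- The smooth cutoff function at scale `R`: it equals `1` on `[-R, R]` and `0` outside
`[-2R, 2R]`. -/
noncomputable def cutoff (R x : ℝ) : ℝ :=
  (⟨1, 2, one_pos, one_lt_two⟩ : ContDiffBump (0 : ℝ)) (x / R)

theorem contDiff_cutoff (R : ℝ) : ContDiff ℝ ∞ (cutoff R) :=
  (ContDiffBump.contDiff _).comp (contDiff_id.div_const R)

theorem cutoff_nonneg (R x : ℝ) : 0 ≤ cutoff R x := ContDiffBump.nonneg _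

theorem cutoff_le_one (R x : ℝ) : cutoff R x ≤ 1 := ContDiffBump.le_one _

theorem abs_cutoff_le_one (R x : ℝ) : |cutoff R x| ≤ 1 :=
  (abs_of_nonneg (cutoff_nonneg R x)).trans_le (cutoff_le_one R x)

theorem cutoff_neg (R x : ℝ) : cutoff R (-x) = cutoff R x := by
  rw [cutoff, neg_div, ContDiffBump.neg, cutoff]

theorem hasCompactSupport_cutoff {R : ℝ} (hR : R ≠ 0) : HasCompactSupport (cutoff R) := by
  have h_eq : cutoff R = fun x =>
      (⟨1, 2, one_pos, one_lt_two⟩ : ContDiffBump (0 : ℝ)) (R⁻¹ • x) := by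
    ext x
    rw [cutoff, smul_eq_mul, inv_mul_eq_div]
  rw [h_eq]
  exact (ContDiffBump.hasCompactSupport _).comp_smul (inv_ne_zero hR)

theorem eventually_cutoff_eventuallyEq_one (x : ℝ) : ∀ᶠ R in atTop, cutoff R =ᶠ[𝓝 x] 1 := by
  filter_upwards [eventually_gt_atTop |x|] with R hR
  have hR0 : 0 < R := (abs_nonneg x).trans_lt hR
  filter_upwards [continuous_abs.continuousAt.eventually_lt_const hR] with y hy
  refine ContDiffBump.one_of_mem_closedBall _ ?_
  rw [mem_closedBall_zero_iff, Real.norm_eq_abs, abs_div, abs_of_pos hR0]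
  exact div_le_one_of_le₀ hy.le hR0.le

theorem exists_deriv_cutoff_sq_le :
    ∃ C, 0 ≤ C ∧ ∀ R, 1 ≤ R → ∀ x, deriv (cutoff R) x ^ 2 ≤ C * (1 + x ^ 2)⁻¹ := by
  let bump : ContDiffBump (0 : ℝ) := ⟨1, 2, one_pos, one_lt_two⟩
  have hcont : Continuous (deriv bump) := bump.contDiff.continuous_deriv (n := 1) le_rfl
  have hsupp : HasCompactSupport fun u => deriv bump u ^ 2 * (1 + u ^ 2) :=
    (bump.hasCompactSupport.deriv.comp_left (g := (· ^ 2)) (by simp)).mul_right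
  obtain ⟨C, hC⟩ := hsupp.exists_bound_of_continuous (by fun_prop)
  refine ⟨C, (norm_nonneg _).trans (hC 0), fun R hR x => ?_⟩
  have : 0 < R := by linarith
  have hderiv : deriv (cutoff R) x = R⁻¹ * deriv bump (x / R) := by
    have := (((bump.contDiff (n := 1)).differentiable one_ne_zero (x / R)).hasDerivAt.comp x
      ((hasDerivAt_id x).div_const R)).deriv
    rw [one_div, mul_comm] at this
    exact this
  rw [← div_eq_mul_inv, le_div_iff₀ (by positivity)]
  calc deriv (cutoff R) x ^ 2 * (1 + x ^ 2)
      = deriv bump (x / R) ^ 2 * (R⁻¹ ^ 2 + (x / R) ^ 2) := by rw [hderiv]; ring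
    _ ≤ deriv bump (x / R) ^ 2 * (1 + (x / R) ^ 2) := by
        gcongr
        exact pow_le_one₀ (by positivity) (inv_le_one_of_one_le₀ hR)
    _ ≤ C := (Real.le_norm_self _).trans (hC _)

theorem sq_sub_cutoff_div_le {C R : ℝ} (hC : ∀ x, deriv (cutoff R) x ^ 2 ≤ C) (x y : ℝ) :
    (|x - y|⁻¹ * (cutoff R x - cutoff R y)) ^ 2 ≤ (C + 1) * (1 + (x - y) ^ 2)⁻¹ := by
  have hC0 : 0 ≤ C := (sq_nonneg _).trans (hC 0)
  have lipschitz : (cutoff R x - cutoff R y) ^ 2 ≤ C * (x - y) ^ 2 := by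
    have hdiff := (contDiff_cutoff R).differentiable (by simp)
    have h := convex_univ.norm_image_sub_le_of_norm_deriv_le (fun x _ => hdiff x)
      (fun x _ => Real.abs_le_sqrt (hC x)) (Set.mem_univ y) (Set.mem_univ x)
    simpa only [mul_pow, Real.sq_sqrt hC0, Real.norm_eq_abs, sq_abs] using
      pow_le_pow_left₀ (norm_nonneg _) h 2
  have bounded : (cutoff R x - cutoff R y) ^ 2 ≤ 1 := by
    rw [sq_le_one_iff_abs_le_one, abs_le]
    constructor <;> linarith [cutoff_nonneg R x, cutoff_le_one R x, cutoff_nonneg R y,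
      cutoff_le_one R y]
  rw [mul_pow, inv_pow, sq_abs, inv_mul_eq_div]
  refine div_le_of_le_mul₀ (by positivity) (by positivity) ?_
  rw [← div_eq_mul_inv, div_mul_eq_mul_div, le_div_iff₀ (by positivity)]
  linarith [mul_le_mul_of_nonneg_right bounded (sq_nonneg (x - y))]

end Cutoff

/-! ### Cutting off a kernel -/

section KernelCutoff

variable {K : ℝ → ℝ}

theorem tendsto_deriv_cutoff_mul (K : ℝ → ℝ) (h : ℝ) :
    Tendsto (fun R => deriv (fun t => cutoff R t * K t) h) atTop (𝓝 (deriv K h)) := by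
  refine tendsto_const_nhds.congr' ?_
  filter_upwards [eventually_cutoff_eventuallyEq_one h] with R hR
  refine (EventuallyEq.deriv_eq ?_).symm
  filter_upwards [hR] with t ht
  rw [ht, Pi.one_apply, one_mul]

theorem exists_abs_deriv_cutoff_mul_mul_sq_le (hK : Differentiable ℝ K) {c : ℝ}
    (hKc : ∀ h, |K h| * |h| ≤ c) (hKc' : ∀ h, |deriv K h| * h ^ 2 ≤ c) :
    ∃ c', ∀ R, 1 ≤ R → ∀ h, |deriv (fun t => cutoff R t * K t) h| * h ^ 2 ≤ c' := by
  obtain ⟨C, hC0, hC⟩ := exists_deriv_cutoff_sq_le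
  refine ⟨√C * c + c, fun R hR h => ?_⟩
  have hcutoff : |deriv (cutoff R) h| * |h| ≤ √C := by
    rw [← abs_mul]
    refine Real.abs_le_sqrt ?_
    calc (deriv (cutoff R) h * h) ^ 2 ≤ C * (1 + h ^ 2)⁻¹ * h ^ 2 := by
          rw [mul_pow]
          gcongr
          exact hC R hR h
      _ ≤ C := by
          rw [mul_assoc]
          exact mul_le_of_le_one_right hC0 ((inv_mul_le_one₀ (by positivity)).2 (by linarith))
  rw [deriv_fun_mul ((contDiff_cutoff R).differentiable (by simp) h) (hK h)]
  calc |deriv (cutoff R) h * K h + cutoff R h * deriv K h| * h ^ 2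
      ≤ (|deriv (cutoff R) h * K h| + |cutoff R h * deriv K h|) * h ^ 2 := by
        gcongr
        exact abs_add_le _ _
    _ = (|deriv (cutoff R) h| * |h|) * (|K h| * |h|) +
          |cutoff R h| * (|deriv K h| * h ^ 2) := by
        rw [abs_mul, abs_mul, ← sq_abs h]
        ring
    _ ≤ √C * c + 1 * c := by
        gcongr
        exacts [hKc h, abs_cutoff_le_one R h, hKc' h]
    _ = √C * c + c := by rw [one_mul]

theorem tendsto_integral_norm_cutoff_sub_one_mul (hK : Integrable K) :
    Tendsto (fun R => ∫ t, ‖(((cutoff R t - 1) * K t : ℝ) : ℂ)‖) atTop (𝓝 0) := by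
  rw [← integral_zero ℝ ℝ]
  refine tendsto_integral_filter_of_dominated_convergence (fun t => ‖K t‖)
    (Eventually.of_forall fun R => ?_) (Eventually.of_forall fun R => .of_forall fun t => ?_)
    hK.norm (.of_forall fun t => ?_)
  · exact (Complex.continuous_ofReal.comp_aestronglyMeasurable
      (((contDiff_cutoff R).continuous.sub continuous_const).aestronglyMeasurable.mul
        hK.aestronglyMeasurable)).norm
  · rw [norm_norm, Complex.norm_real, norm_mul, Real.norm_eq_abs (cutoff R t - 1)]
    refine mul_le_of_le_one_left (norm_nonneg _) (abs_le.2 ?_)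
    constructor <;> linarith [cutoff_nonneg R t, cutoff_le_one R t]
  · refine tendsto_const_nhds.congr' ?_
    filter_upwards [eventually_cutoff_eventuallyEq_one t] with R hR
    simp [hR.self_of_nhds]

theorem norm_fourier_cutoff_mul_le (hK : Integrable K) {M : ℝ}
    (hM : ∀ ξ, ‖𝓕 (fun t => (K t : ℂ)) ξ‖ ≤ M) (R ξ : ℝ) :
    ‖𝓕 (fun t => ((cutoff R t * K t : ℝ) : ℂ)) ξ‖ ≤
      M + ∫ t, ‖(((cutoff R t - 1) * K t : ℝ) : ℂ)‖ := by
  have h_rem : Integrable fun t => (((cutoff R t - 1) * K t : ℝ) : ℂ) := by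
    refine (hK.bdd_mul (c := 1 + 1) ?_ (.of_forall fun t => ?_)).ofReal
    · exact ((contDiff_cutoff R).continuous.sub continuous_const).aestronglyMeasurable
    · exact (norm_sub_le _ _).trans (add_le_add (abs_cutoff_le_one R t) norm_one.le)
  have h_split : (fun t => ((cutoff R t * K t : ℝ) : ℂ)) =
      (fun t => (K t : ℂ)) + fun t => (((cutoff R t - 1) * K t : ℝ) : ℂ) := by
    ext t
    rw [Pi.add_apply, ← Complex.ofReal_add]
    ring_nf
  have h_add : 𝓕 (fun t => ((cutoff R t * K t : ℝ) : ℂ)) ξ = 𝓕 (fun t => (K t : ℂ)) ξ +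
      𝓕 (fun t => (((cutoff R t - 1) * K t : ℝ) : ℂ)) ξ := by
    rw [h_split]
    exact congrFun (VectorFourier.fourierIntegral_add Real.continuous_fourierChar continuous_inner
      hK.ofReal h_rem) ξ
  rw [h_add]
  exact (norm_add_le _ _).trans (add_le_add (hM ξ)
    (VectorFourier.norm_fourierIntegral_le_integral_norm _ _ _ _ _))

end KernelCutoff

/-! ### The cross product -/

section Wedge

theorem inner_sub_wedge_sub (a b p q : E3) :
    inner ℝ (a - b) (wedge p a - wedge q b) = -inner ℝ (p - q) (wedge a b) := by
  simp only [wedge, PiLp.inner_apply, PiLp.sub_apply, Fin.sum_univ_three, cross_apply,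
    RCLike.inner_apply, conj_trivial, Matrix.cons_val_zero, Matrix.cons_val_one, Matrix.cons_val]
  ring

theorem norm_wedge_sq_add_inner_sq (a b : E3) :
    ‖wedge a b‖ ^ 2 + inner ℝ a b ^ 2 = ‖a‖ ^ 2 * ‖b‖ ^ 2 := by
  simp only [← real_inner_self_eq_norm_sq, EuclideanSpace.inner_eq_star_dotProduct, star_trivial,
    wedge, cross_dot_cross, dotProduct_comm b.ofLp a.ofLp]
  ring

theorem norm_wedge_sq {a b : E3} (ha : ‖a‖ = 1) (hb : ‖b‖ = 1) :
    ‖wedge a b‖ ^ 2 = ‖a - b‖ ^ 2 - ‖a - b‖ ^ 4 / 4 := by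
  have h_wedge := norm_wedge_sq_add_inner_sq a b
  have h_sub := norm_sub_sq_real a b
  rw [ha, hb] at h_wedge h_sub
  rw [show ‖a - b‖ ^ 4 = (‖a - b‖ ^ 2) ^ 2 by ring, h_sub]
  linear_combination h_wedge

theorem continuous_wedge : Continuous fun p : E3 × E3 => wedge p.1 p.2 := by
  simp only [wedge, cross_apply]
  fun_prop

end Wedge

/-! ### Square integrable functions -/

section SquareIntegrable

variable {α E : Type*} [MeasurableSpace α] {μ : Measure α} [NormedAddCommGroup E]

theorem eLpNorm_two_sq (f : α → E) : eLpNorm f 2 μ ^ 2 = ∫⁻ x, ‖f x‖ₑ ^ 2 ∂μ := by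
  simpa using eLpNorm_nnreal_pow_eq_lintegral (μ := μ) (f := f) (p := 2) two_ne_zero

theorem integral_norm_sq_eq_toReal {f : α → E} (hf : AEStronglyMeasurable f μ) :
    ∫ x, ‖f x‖ ^ 2 ∂μ = (eLpNorm f 2 μ ^ 2).toReal := by
  rw [eLpNorm_two_sq, integral_eq_lintegral_of_nonneg_ae (f := fun x => ‖f x‖ ^ 2)
    (.of_forall fun x => sq_nonneg _) (hf.norm.pow 2)]
  simp only [ENNReal.ofReal_pow (norm_nonneg _), ofReal_norm]

theorem integrable_norm_sq_of_memLp_two {f : α → E} (hf : MemLp f 2 μ) :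
    Integrable (fun x => ‖f x‖ ^ 2) μ :=
  (memLp_two_iff_integrable_sq_norm hf.1).1 hf

theorem enorm_integral_smul_sq_le [NormedSpace ℝ E] {k : α → ℝ} {f : α → E}
    (hk : AEStronglyMeasurable k μ) (hf : AEStronglyMeasurable f μ) :
    ‖∫ x, k x • f x ∂μ‖ₑ ^ 2 ≤ (∫⁻ x, ‖k x‖ₑ ^ 2 ∂μ) * ∫⁻ x, ‖f x‖ₑ ^ 2 ∂μ := by
  rw [← eLpNorm_two_sq, ← eLpNorm_two_sq, ← mul_pow]
  gcongr
  calc ‖∫ x, k x • f x ∂μ‖ₑ ≤ eLpNorm (k • f) 1 μ := by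
        rw [eLpNorm_one_eq_lintegral_enorm]
        exact enorm_integral_le_lintegral_enorm _
    _ ≤ eLpNorm k 2 μ * eLpNorm f 2 μ := eLpNorm_smul_le_mul_eLpNorm hf hk

theorem abs_inner_le_half [InnerProductSpace ℝ E] (a b : E) :
    |inner ℝ a b| ≤ (‖a‖ ^ 2 + ‖b‖ ^ 2) / 2 := by
  linarith [abs_real_inner_le_norm a b, two_mul_le_add_sq ‖a‖ ‖b‖]

theorem abs_integral_inner_le_half [InnerProductSpace ℝ E] {f g : α → E} (hf : MemLp f 2 μ)
    (hg : MemLp g 2 μ) :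
    |∫ x, inner ℝ (f x) (g x) ∂μ| ≤ (∫ x, ‖f x‖ ^ 2 ∂μ + ∫ x, ‖g x‖ ^ 2 ∂μ) / 2 := by
  have hf2 := integrable_norm_sq_of_memLp_two hf
  have hg2 := integrable_norm_sq_of_memLp_two hg
  have hfg : Integrable (fun x => (‖f x‖ ^ 2 + ‖g x‖ ^ 2) / 2) μ := (hf2.add hg2).div_const 2
  rw [← integral_add hf2 hg2, ← integral_div, ← Real.norm_eq_abs]
  exact norm_integral_le_of_norm_le hfg (.of_forall fun x => abs_inner_le_half (f x) (g x))

end SquareIntegrable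

/-! ### Difference quotients -/

section DiffQuot

variable {E : Type*} [NormedAddCommGroup E] [NormedSpace ℝ E] {f : ℝ → E}

/-- The difference quotient `(f x - f y) / |x - y|`, whose `L²` norm over `ℝ × ℝ` is the
Gagliardo seminorm of `f`. -/
noncomputable def diffQuot (f : ℝ → E) (z : ℝ × ℝ) : E := |z.1 - z.2|⁻¹ • (f z.1 - f z.2)

/-- The quotient `(f x ∧ f y) / |x - y|`, against which the weak form of `f ∧ |∇| f` pairs the
difference quotients of test functions. -/
noncomputable def wedgeQuot (f : ℝ → E3) (z : ℝ × ℝ) : E3 :=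
  |z.1 - z.2|⁻¹ • wedge (f z.1) (f z.2)

theorem norm_diffQuot_sq (f : ℝ → E) (z : ℝ × ℝ) :
    ‖diffQuot f z‖ ^ 2 = ‖f z.1 - f z.2‖ ^ 2 / |z.1 - z.2| ^ 2 := by
  rw [diffQuot, norm_smul, mul_pow, norm_inv, Real.norm_eq_abs, abs_abs, inv_pow, inv_mul_eq_div]

theorem norm_wedgeQuot_sq (f : ℝ → E3) (z : ℝ × ℝ) :
    ‖wedgeQuot f z‖ ^ 2 = ‖wedge (f z.1) (f z.2)‖ ^ 2 / |z.1 - z.2| ^ 2 := by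
  rw [wedgeQuot, norm_smul, mul_pow, norm_inv, Real.norm_eq_abs, abs_abs, inv_pow, inv_mul_eq_div]

theorem aestronglyMeasurable_abs_sub_inv :
    AEStronglyMeasurable fun z : ℝ × ℝ => |z.1 - z.2|⁻¹ :=
  (by fun_prop : Measurable fun z : ℝ × ℝ => |z.1 - z.2|⁻¹).aestronglyMeasurable

theorem aestronglyMeasurable_diffQuot (hf : AEStronglyMeasurable f) :
    AEStronglyMeasurable (diffQuot f) :=
  aestronglyMeasurable_abs_sub_inv.smul (hf.comp_fst.sub hf.comp_snd)

theorem aestronglyMeasurable_wedgeQuot {f : ℝ → E3} (hf : AEStronglyMeasurable f) :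
    AEStronglyMeasurable (wedgeQuot f) :=
  aestronglyMeasurable_abs_sub_inv.smul
    (continuous_wedge.comp_aestronglyMeasurable (hf.comp_fst.prodMk hf.comp_snd))

theorem gagliardo_eq_eLpNorm_sq (f : ℝ → E) : gagliardo f = eLpNorm (diffQuot f) 2 ^ 2 := by
  simp only [eLpNorm_two_sq, gagliardo, ← norm_diffQuot_sq, ENNReal.ofReal_pow (norm_nonneg _),
    ofReal_norm]

theorem memLp_diffQuot (hf : AEStronglyMeasurable f) (hgag : gagliardo f < ⊤) :
    MemLp (diffQuot f) 2 := by
  rw [gagliardo_eq_eLpNorm_sq, ENNReal.pow_lt_top_iff, or_iff_left two_ne_zero] at hgag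
  exact ⟨aestronglyMeasurable_diffQuot hf, hgag⟩

theorem eLpNorm_diffQuot_sq_eq_lintegral (hf : AEStronglyMeasurable f) :
    eLpNorm (diffQuot f) 2 ^ 2 =
      ∫⁻ h, ‖|h|⁻¹‖ₑ ^ 2 * eLpNorm (fun x => f (h + x) - f x) 2 ^ 2 := by
  have hmeas : AEMeasurable fun z => ‖diffQuot f z‖ₑ ^ 2 :=
    (aestronglyMeasurable_diffQuot hf).enorm.pow_const 2
  have hshear := measurePreserving_add_prod (volume : Measure ℝ) (volume : Measure ℝ)
  rw [eLpNorm_two_sq, Measure.volume_eq_prod, ← hshear.map_eq,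
    lintegral_map' (by rwa [hshear.map_eq]) hshear.aemeasurable]
  refine (lintegral_prod _
    (hmeas.comp_quasiMeasurePreserving hshear.quasiMeasurePreserving)).trans ?_
  refine lintegral_congr fun h => ?_
  rw [eLpNorm_two_sq, ← lintegral_const_mul' _ _ (ENNReal.pow_ne_top enorm_ne_top)]
  simp only [diffQuot, enorm_smul, mul_pow, Function.comp_apply, add_sub_cancel_right]

end DiffQuot

/-! ### Convolution with odd kernels -/

section OddKernel

variable {K : ℝ → ℝ} {E : Type*} [NormedAddCommGroup E] [NormedSpace ℝ E] {f : ℝ → E}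

theorem integrable_smul_comp_sub (hK : Continuous K) (hKc : HasCompactSupport K)
    (hf : LocallyIntegrable f) (x : ℝ) : Integrable fun y => K (x - y) • f y :=
  (convolutionExistsAt_iff_integrable_swap (L := lsmul ℝ ℝ)).1
    (hKc.convolutionExists_left _ hK hf x)

theorem convolution_add_sub_convolution (hK : Continuous K) (hKc : HasCompactSupport K)
    (hf : LocallyIntegrable f) (h x : ℝ) :
    (K ⋆[lsmul ℝ ℝ] f) (h + x) - (K ⋆[lsmul ℝ ℝ] f) x =
      (K ⋆[lsmul ℝ ℝ] fun y => f (h + y) - f y) x := by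
  have integrable_smul (y : ℝ) : Integrable fun t => K t • f (y - t) :=
    hKc.convolutionExists_left (lsmul ℝ ℝ) hK hf y
  simp only [convolution_lsmul]
  rw [← integral_sub (integrable_smul (h + x)) (integrable_smul x)]
  simp only [smul_sub, add_sub_assoc]

theorem eLpNorm_diffQuot_convolution_le {ι : Type*} [Fintype ι] {f : ℝ → EuclideanSpace ℝ ι}
    (hK : ContDiff ℝ ∞ K) (hKc : HasCompactSupport K) {M : ℝ} (hM0 : 0 < M)
    (hM : ∀ ξ, ‖𝓕 (fun t => (K t : ℂ)) ξ‖ ≤ M) (hf : LocallyIntegrable f) :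
    eLpNorm (diffQuot (K ⋆[lsmul ℝ ℝ] f)) 2 ≤ ENNReal.ofReal M * eLpNorm (diffQuot f) 2 := by
  have translate (h : ℝ) : eLpNorm (K ⋆[lsmul ℝ ℝ] fun y => f (h + y) - f y) 2 ≤
      ENNReal.ofReal M * eLpNorm (fun y => f (h + y) - f y) 2 := by
    by_cases htop : eLpNorm (fun y => f (h + y) - f y) 2 = ⊤
    · rw [htop, ENNReal.mul_top (by simpa using hM0)]
      exact le_top
    · refine eLpNorm_two_real_convolution_le hK hKc hM ⟨?_, lt_top_iff_ne_top.2 htop⟩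
      exact (hf.aestronglyMeasurable.comp_measurePreserving
        (measurePreserving_add_left volume h)).sub hf.aestronglyMeasurable
  have hcont : Continuous (K ⋆[lsmul ℝ ℝ] f) :=
    (hKc.contDiff_convolution_left _ hK hf).continuous
  rw [← ENNReal.pow_le_pow_left_iff two_ne_zero, mul_pow,
    eLpNorm_diffQuot_sq_eq_lintegral hcont.aestronglyMeasurable,
    eLpNorm_diffQuot_sq_eq_lintegral hf.aestronglyMeasurable,
    ← lintegral_const_mul' _ _ (by simp)]
  refine lintegral_mono fun h => ?_
  simp only [convolution_add_sub_convolution hK.continuous hKc hf]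
  rw [mul_left_comm, ← mul_pow (ENNReal.ofReal M)]
  gcongr
  exact translate h

theorem memLp_diffQuot_convolution {ι : Type*} [Fintype ι] {f : ℝ → EuclideanSpace ℝ ι}
    (hK : ContDiff ℝ ∞ K) (hKc : HasCompactSupport K) {M : ℝ} (hM0 : 0 < M)
    (hM : ∀ ξ, ‖𝓕 (fun t => (K t : ℂ)) ξ‖ ≤ M) (hf : LocallyIntegrable f)
    (hd : MemLp (diffQuot f) 2) : MemLp (diffQuot (K ⋆[lsmul ℝ ℝ] f)) 2 :=
  ⟨aestronglyMeasurable_diffQuot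
      (hKc.contDiff_convolution_left _ hK hf).continuous.aestronglyMeasurable,
    (eLpNorm_diffQuot_convolution_le hK hKc hM0 hM hf).trans_lt
      (ENNReal.mul_lt_top ENNReal.ofReal_lt_top hd.2)⟩

theorem integral_norm_diffQuot_convolution_sq_le {ι : Type*} [Fintype ι]
    {f : ℝ → EuclideanSpace ℝ ι} (hK : ContDiff ℝ ∞ K) (hKc : HasCompactSupport K) {M : ℝ}
    (hM0 : 0 < M) (hM : ∀ ξ, ‖𝓕 (fun t => (K t : ℂ)) ξ‖ ≤ M) (hf : LocallyIntegrable f)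
    (hd : MemLp (diffQuot f) 2) :
    ∫ z, ‖diffQuot (K ⋆[lsmul ℝ ℝ] f) z‖ ^ 2 ≤ M ^ 2 * ∫ z, ‖diffQuot f z‖ ^ 2 := by
  rw [integral_norm_sq_eq_toReal (memLp_diffQuot_convolution hK hKc hM0 hM hf hd).1,
    integral_norm_sq_eq_toReal hd.1, ← ENNReal.toReal_ofReal (sq_nonneg M), ← ENNReal.toReal_mul,
    ENNReal.ofReal_pow hM0.le, ← mul_pow]
  refine ENNReal.toReal_mono
    (ENNReal.pow_ne_top (ENNReal.mul_ne_top ENNReal.ofReal_ne_top hd.2.ne)) ?_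
  gcongr
  exact eLpNorm_diffQuot_convolution_le hK hKc hM0 hM hf

theorem integral_eq_zero_of_odd (hodd : f.Odd) : ∫ t, f t = 0 := by
  have : IsAddTorsionFree E := .of_isTorsionFree ℝ E
  have h := integral_neg_eq_self f volume
  simp only [hodd _, integral_neg] at h
  exact self_eq_neg.1 h.symm

theorem smul_diffQuot (x y : ℝ) : |x - y| • diffQuot f (x, y) = f x - f y := by
  rcases eq_or_ne x y with rfl | hxy
  · simp
  · rw [diffQuot, smul_inv_smul₀ (abs_ne_zero.2 (sub_ne_zero.2 hxy))]

theorem convolution_eq_neg_integral_diffQuot (hK : Continuous K) (hKc : HasCompactSupport K)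
    (hodd : K.Odd) (hf : LocallyIntegrable f) (x : ℝ) :
    (K ⋆[lsmul ℝ ℝ] f) x = -∫ y, (K (x - y) * |x - y|) • diffQuot f (x, y) := by
  have hKx : Integrable fun y => K (x - y) • f x :=
    ((hK.integrable_of_hasCompactSupport hKc).comp_sub_left x).smul_const _
  have hKx0 : ∫ y, K (x - y) • f x = 0 := by
    rw [integral_sub_left_eq_self fun t => K t • f x]
    exact integral_eq_zero_of_odd fun t => by rw [hodd, neg_smul]
  simp only [mul_smul, smul_diffQuot, smul_sub]
  rw [integral_sub hKx (integrable_smul_comp_sub hK hKc hf x), hKx0, zero_sub, neg_neg,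
    convolution_lsmul_swap]

theorem memLp_convolution_of_odd (hK : ContDiff ℝ ∞ K) (hKc : HasCompactSupport K)
    (hodd : K.Odd) (hf : LocallyIntegrable f) (hd : MemLp (diffQuot f) 2) :
    MemLp (K ⋆[lsmul ℝ ℝ] f) 2 := by
  refine ⟨(hKc.contDiff_convolution_left _ hK hf).continuous.aestronglyMeasurable, ?_⟩
  have hKabs : MemLp (fun t => K t * |t|) 2 :=
    (hK.continuous.mul continuous_abs).memLp_of_hasCompactSupport hKc.mul_right
  have hdiff (x : ℝ) : AEStronglyMeasurable fun y => diffQuot f (x, y) := by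
    simp only [diffQuot]
    exact (by fun_prop : Measurable fun y : ℝ => |x - y|⁻¹).aestronglyMeasurable.smul
      (aestronglyMeasurable_const.sub hf.aestronglyMeasurable)
  have pointwise (x : ℝ) : ‖(K ⋆[lsmul ℝ ℝ] f) x‖ₑ ^ 2 ≤
      eLpNorm (fun t => K t * |t|) 2 ^ 2 * ∫⁻ y, ‖diffQuot f (x, y)‖ₑ ^ 2 := by
    rw [convolution_eq_neg_integral_diffQuot hK.continuous hKc hodd hf, enorm_neg]
    refine (enorm_integral_smul_sq_le ?_ (hdiff x)).trans_eq ?_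
    · exact (by fun_prop : Continuous fun y => K (x - y) * |x - y|).aestronglyMeasurable
    · rw [eLpNorm_two_sq, lintegral_sub_left_eq_self (fun t => ‖K t * |t|‖ₑ ^ 2)]
  have henergy : ∫⁻ x, ∫⁻ y, ‖diffQuot f (x, y)‖ₑ ^ 2 = eLpNorm (diffQuot f) 2 ^ 2 := by
    rw [eLpNorm_two_sq, Measure.volume_eq_prod]
    exact (lintegral_prod _ (hd.1.enorm.pow_const 2)).symm
  have hsq : eLpNorm (K ⋆[lsmul ℝ ℝ] f) 2 ^ 2 < ⊤ := calc
    eLpNorm (K ⋆[lsmul ℝ ℝ] f) 2 volume ^ 2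
      ≤ ∫⁻ x, eLpNorm (fun t => K t * |t|) 2 volume ^ 2 * ∫⁻ y, ‖diffQuot f (x, y)‖ₑ ^ 2 := by
        rw [eLpNorm_two_sq]
        exact lintegral_mono pointwise
    _ = (eLpNorm (fun t => K t * |t|) 2 volume * eLpNorm (diffQuot f) 2 volume) ^ 2 := by
        rw [lintegral_const_mul' _ _ (ENNReal.pow_ne_top hKabs.2.ne), henergy, mul_pow]
    _ < ⊤ := ENNReal.pow_lt_top (ENNReal.mul_lt_top hKabs.2 hd.2)
  simpa [ENNReal.pow_lt_top_iff] using hsq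

end OddKernel

/-! ### Square integrable test functions -/

section CutoffTest

variable {E : Type*} [NormedAddCommGroup E] [InnerProductSpace ℝ E] {ψ : ℝ → E}

theorem diffQuot_cutoff_smul (R : ℝ) (ψ : ℝ → E) (z : ℝ × ℝ) :
    diffQuot (fun x => cutoff R x • ψ x) z = cutoff R z.1 • diffQuot ψ z +
      (|z.1 - z.2|⁻¹ * (cutoff R z.1 - cutoff R z.2)) • ψ z.2 := by
  simp only [diffQuot]
  module

theorem exists_norm_diffQuot_cutoff_smul_sq_le :
    ∃ C, ∀ R, 1 ≤ R → ∀ (ψ : ℝ → E) z, ‖diffQuot (fun x => cutoff R x • ψ x) z‖ ^ 2 ≤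
      2 * (‖diffQuot ψ z‖ ^ 2 + C * (‖ψ z.2‖ ^ 2 * (1 + (z.1 - z.2) ^ 2)⁻¹)) := by
  obtain ⟨C, hC0, hC⟩ := exists_deriv_cutoff_sq_le
  have hC' (R : ℝ) (hR : 1 ≤ R) (x : ℝ) : deriv (cutoff R) x ^ 2 ≤ C :=
    (hC R hR x).trans (mul_le_of_le_one_right hC0
      (inv_le_one_of_one_le₀ (le_add_of_nonneg_right (sq_nonneg x))))
  refine ⟨C + 1, fun R hR ψ z => ?_⟩
  have h_main : ‖cutoff R z.1 • diffQuot ψ z‖ ≤ ‖diffQuot ψ z‖ := by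
    rw [norm_smul]
    exact mul_le_of_le_one_left (norm_nonneg _) (abs_cutoff_le_one R z.1)
  have h_comm : ‖(|z.1 - z.2|⁻¹ * (cutoff R z.1 - cutoff R z.2)) • ψ z.2‖ ^ 2 ≤
      (C + 1) * (‖ψ z.2‖ ^ 2 * (1 + (z.1 - z.2) ^ 2)⁻¹) := by
    rw [norm_smul, mul_pow, Real.norm_eq_abs, sq_abs, mul_comm (‖ψ z.2‖ ^ 2), ← mul_assoc]
    gcongr
    exact sq_sub_cutoff_div_le (hC' R hR) z.1 z.2
  rw [diffQuot_cutoff_smul]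
  calc ‖cutoff R z.1 • diffQuot ψ z +
        (|z.1 - z.2|⁻¹ * (cutoff R z.1 - cutoff R z.2)) • ψ z.2‖ ^ 2
      ≤ (‖cutoff R z.1 • diffQuot ψ z‖ +
          ‖(|z.1 - z.2|⁻¹ * (cutoff R z.1 - cutoff R z.2)) • ψ z.2‖) ^ 2 := by
        gcongr
        exact norm_add_le _ _
    _ ≤ 2 * (‖cutoff R z.1 • diffQuot ψ z‖ ^ 2 +
          ‖(|z.1 - z.2|⁻¹ * (cutoff R z.1 - cutoff R z.2)) • ψ z.2‖ ^ 2) := add_sq_le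
    _ ≤ _ := by gcongr

theorem integrable_norm_sq_mul_inv_one_add_sq {F : Type*} [NormedAddCommGroup F] {u : ℝ → F}
    (hu : MemLp u 2) : Integrable fun z : ℝ × ℝ => ‖u z.2‖ ^ 2 * (1 + (z.1 - z.2) ^ 2)⁻¹ :=
  (integrable_norm_sq_of_memLp_two hu).convolution_integrand (lsmul ℝ ℝ) integrable_inv_one_add_sq

theorem tendsto_integral_inner_diffQuot_cutoff_smul (hψ : MemLp ψ 2) (hdψ : MemLp (diffQuot ψ) 2)
    {w : ℝ × ℝ → E} (hw : MemLp w 2) :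
    Tendsto (fun R => ∫ z, inner ℝ (diffQuot (fun x => cutoff R x • ψ x) z) (w z)) atTop
      (𝓝 (∫ z, inner ℝ (diffQuot ψ z) (w z))) := by
  obtain ⟨C, hC⟩ := exists_norm_diffQuot_cutoff_smul_sq_le (E := E)
  refine tendsto_integral_filter_of_dominated_convergence (fun z => ‖diffQuot ψ z‖ ^ 2 +
      C * (‖ψ z.2‖ ^ 2 * (1 + (z.1 - z.2) ^ 2)⁻¹) + ‖w z‖ ^ 2 / 2) (.of_forall fun R => ?_) ?_
    (((integrable_norm_sq_of_memLp_two hdψ).add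
      ((integrable_norm_sq_mul_inv_one_add_sq hψ).const_mul C)).add
        ((integrable_norm_sq_of_memLp_two hw).div_const 2)) (.of_forall fun z => ?_)
  · exact (aestronglyMeasurable_diffQuot
      ((contDiff_cutoff R).continuous.aestronglyMeasurable.smul hψ.1)).inner hw.1
  · filter_upwards [eventually_ge_atTop 1] with R hR
    refine .of_forall fun z => ?_
    rw [Real.norm_eq_abs]
    linarith [hC R hR ψ z, abs_inner_le_half (diffQuot (fun x => cutoff R x • ψ x) z) (w z)]
  · refine tendsto_const_nhds.congr' ?_
    filter_upwards [eventually_cutoff_eventuallyEq_one z.1, eventually_cutoff_eventuallyEq_one z.2]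
      with R h1 h2
    simp only [diffQuot, h1.self_of_nhds, h2.self_of_nhds, Pi.one_apply, one_smul]

theorem tendsto_integral_inner_deriv_cutoff_smul (hψ : ContDiff ℝ ∞ ψ) (hψ2 : MemLp ψ 2)
    {u : ℝ → E} (hu : AEStronglyMeasurable u) (hu1 : ∀ᵐ x, ‖u x‖ ≤ 1)
    (hint : Integrable fun x => (inner ℝ (u x) (deriv ψ x) : ℝ)) :
    Tendsto (fun R => ∫ x, inner ℝ (u x) (deriv (fun t => cutoff R t • ψ t) x)) atTop
      (𝓝 (∫ x, inner ℝ (u x) (deriv ψ x))) := by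
  obtain ⟨C, -, hC⟩ := exists_deriv_cutoff_sq_le
  have product_rule (R x : ℝ) : deriv (fun t => cutoff R t • ψ t) x =
      cutoff R x • deriv ψ x + deriv (cutoff R) x • ψ x :=
    deriv_fun_smul ((contDiff_cutoff R).differentiable (by simp) x)
      (hψ.differentiable (by simp) x)
  refine tendsto_integral_filter_of_dominated_convergence
    (fun x => |inner ℝ (u x) (deriv ψ x)| + (C * (1 + x ^ 2)⁻¹ + ‖ψ x‖ ^ 2) / 2)
    (.of_forall fun R => ?_) ?_ (hint.abs.add (((integrable_inv_one_add_sq.const_mul C).add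
      (integrable_norm_sq_of_memLp_two hψ2)).div_const 2)) (.of_forall fun x => ?_)
  · exact hu.inner (((contDiff_cutoff R).smul hψ).continuous_deriv (by simp)).aestronglyMeasurable
  · filter_upwards [eventually_ge_atTop 1] with R hR
    filter_upwards [hu1] with x hx
    rw [product_rule, inner_add_right, real_inner_smul_right, real_inner_smul_right]
    refine (norm_add_le _ _).trans (add_le_add ?_ ?_)
    · rw [norm_mul]
      exact mul_le_of_le_one_left (abs_nonneg _) (abs_cutoff_le_one R x)
    · have h_inner : |inner ℝ (u x) (ψ x)| ≤ ‖ψ x‖ :=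
        (abs_real_inner_le_norm _ _).trans (mul_le_of_le_one_left (norm_nonneg _) hx)
      calc ‖deriv (cutoff R) x * inner ℝ (u x) (ψ x)‖
          ≤ |deriv (cutoff R) x| * ‖ψ x‖ := by
            rw [norm_mul]
            exact mul_le_mul_of_nonneg_left h_inner (abs_nonneg _)
        _ ≤ (deriv (cutoff R) x ^ 2 + ‖ψ x‖ ^ 2) / 2 := by
            linarith [two_mul_le_add_sq |deriv (cutoff R) x| ‖ψ x‖, sq_abs (deriv (cutoff R) x)]
        _ ≤ _ := by
            gcongr
            exact hC R hR x
  · refine tendsto_const_nhds.congr' ?_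
    filter_upwards [eventually_cutoff_eventuallyEq_one x] with R hR
    have h_eq : (fun t => cutoff R t • ψ t) =ᶠ[𝓝 x] ψ := by
      filter_upwards [hR] with t ht
      rw [ht, Pi.one_apply, one_smul]
    rw [h_eq.deriv_eq]

end CutoffTest

section ExtendedTest

variable {v : ℝ} {Q : ℝ → E3}

theorem ae_fst_snd_of_ae {P : ℝ → Prop} (hP : ∀ᵐ x, P x) : ∀ᵐ z : ℝ × ℝ, P z.1 ∧ P z.2 := by
  rw [Measure.volume_eq_prod]
  exact (Measure.quasiMeasurePreserving_fst.ae hP).and (Measure.quasiMeasurePreserving_snd.ae hP)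

theorem ae_norm_wedgeQuot_sq_eq (hQ1 : ∀ᵐ x, ‖Q x‖ = 1) :
    ∀ᵐ z, ‖wedgeQuot Q z‖ ^ 2 =
      ‖diffQuot Q z‖ ^ 2 - ‖Q z.1 - Q z.2‖ ^ 4 / (4 * |z.1 - z.2| ^ 2) := by
  filter_upwards [ae_fst_snd_of_ae hQ1] with z hz
  rw [norm_wedgeQuot_sq, norm_diffQuot_sq, norm_wedge_sq hz.1 hz.2, sub_div, div_div]

theorem memLp_wedgeQuot (hQ : AEStronglyMeasurable Q) (hQ1 : ∀ᵐ x, ‖Q x‖ = 1)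
    (hd : MemLp (diffQuot Q) 2) : MemLp (wedgeQuot Q) 2 := by
  refine hd.mono (aestronglyMeasurable_wedgeQuot hQ) ?_
  filter_upwards [ae_norm_wedgeQuot_sq_eq hQ1] with z hz
  refine (sq_le_sq₀ (norm_nonneg _) (norm_nonneg _)).1 (hz.trans_le (sub_le_self _ ?_))
  positivity

theorem wedgeAbsGrad_eq_integral (Q φ : ℝ → E3) :
    wedgeAbsGrad Q φ =
      -(1 / (2 * Real.pi) * ∫ z : ℝ × ℝ, inner ℝ (diffQuot φ z) (wedgeQuot Q z)) := by
  rw [wedgeAbsGrad, absGradPairing, ← mul_neg, ← integral_neg]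
  congr 2 with z
  simp only [inner_sub_wedge_sub, diffQuot, wedgeQuot, real_inner_smul_left,
    real_inner_smul_right]
  ring

theorem SolvesProfile.integral_inner_eq (h : SolvesProfile v Q) {φ : ℝ → E3}
    (hφ : ContDiff ℝ ∞ φ) (hφc : HasCompactSupport φ) :
    ∫ z, inner ℝ (diffQuot φ z) (wedgeQuot Q z) =
      2 * Real.pi * v * ∫ x, inner ℝ (Q x) (deriv φ x) := by
  have h_weak := h φ hφ hφc
  rw [wedgeAbsGrad_eq_integral, distribDeriv] at h_weak
  have := Real.pi_ne_zero
  field_simp at h_weak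
  linarith

theorem SolvesProfile.integral_inner_eq_of_memLp (h : SolvesProfile v Q)
    (hQ : AEStronglyMeasurable Q) (hQ1 : ∀ᵐ x, ‖Q x‖ = 1) (hd : MemLp (diffQuot Q) 2)
    {ψ : ℝ → E3} (hψ : ContDiff ℝ ∞ ψ) (hψ2 : MemLp ψ 2) (hdψ : MemLp (diffQuot ψ) 2)
    (hint : Integrable fun x => (inner ℝ (Q x) (deriv ψ x) : ℝ)) :
    ∫ z, inner ℝ (diffQuot ψ z) (wedgeQuot Q z) =
      2 * Real.pi * v * ∫ x, inner ℝ (Q x) (deriv ψ x) := by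
  refine tendsto_nhds_unique (tendsto_integral_inner_diffQuot_cutoff_smul hψ2 hdψ
    (memLp_wedgeQuot hQ hQ1 hd)) (((tendsto_integral_inner_deriv_cutoff_smul hψ hψ2 hQ
      (hQ1.mono fun x hx => hx.le) hint).const_mul _).congr' ?_)
  filter_upwards [eventually_ne_atTop 0] with R hR
  exact (h.integral_inner_eq ((contDiff_cutoff R).smul hψ)
    (hasCompactSupport_cutoff hR).smul_right).symm

end ExtendedTest

/-! ### The energy identity -/

section KernelEnergy

variable {E : Type*} [NormedAddCommGroup E]

theorem integral_deriv_eq_zero_of_hasCompactSupport [NormedSpace ℝ E] {f : ℝ → E}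
    (hf : ContDiff ℝ 1 f) (hfc : HasCompactSupport f) : ∫ x, deriv f x = 0 :=
  integral_eq_zero_of_hasDerivAt_of_integrable
    (fun x => (hf.differentiable one_ne_zero x).hasDerivAt)
    ((hf.continuous_deriv le_rfl).integrable_of_hasCompactSupport hfc.deriv)
    (hf.continuous.integrable_of_hasCompactSupport hfc)

section KernelBound

variable [NormedSpace ℝ E] {f : ℝ → E} {k : ℝ → ℝ} {c : ℝ}

theorem abs_mul_norm_sub_sq_le (hkc : ∀ h, |k h| * h ^ 2 ≤ c) (f : ℝ → E) (z : ℝ × ℝ) :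
    |k (z.1 - z.2) * ‖f z.1 - f z.2‖ ^ 2| ≤ c * ‖diffQuot f z‖ ^ 2 := by
  have h_eq : ‖f z.1 - f z.2‖ ^ 2 = (z.1 - z.2) ^ 2 * ‖diffQuot f z‖ ^ 2 := by
    rw [← smul_diffQuot z.1 z.2, norm_smul, mul_pow, Real.norm_eq_abs, abs_abs, sq_abs]
  calc |k (z.1 - z.2) * ‖f z.1 - f z.2‖ ^ 2|
      = |k (z.1 - z.2)| * (z.1 - z.2) ^ 2 * ‖diffQuot f z‖ ^ 2 := by
        rw [abs_mul, abs_of_nonneg (sq_nonneg ‖f z.1 - f z.2‖), mul_assoc, h_eq]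
    _ ≤ c * ‖diffQuot f z‖ ^ 2 := by
        gcongr
        exact hkc _

theorem integrable_mul_norm_sub_sq (hk : Continuous k) (hkc : ∀ h, |k h| * h ^ 2 ≤ c)
    (hf : AEStronglyMeasurable f) (hd : MemLp (diffQuot f) 2) :
    Integrable fun z : ℝ × ℝ => k (z.1 - z.2) * ‖f z.1 - f z.2‖ ^ 2 := by
  refine ((integrable_norm_sq_of_memLp_two hd).const_mul c).mono' ?_
    (.of_forall (abs_mul_norm_sub_sq_le hkc f))
  exact (hk.comp (continuous_fst.sub continuous_snd)).aestronglyMeasurable.mul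
    ((hf.comp_fst.sub hf.comp_snd).norm.pow 2)

theorem tendsto_integral_mul_norm_sub_sq {k : ℝ → ℝ → ℝ} {k₀ : ℝ → ℝ}
    (hk : ∀ᶠ R in atTop, Continuous (k R)) (hkc : ∀ᶠ R in atTop, ∀ h, |k R h| * h ^ 2 ≤ c)
    (hlim : ∀ h ≠ 0, Tendsto (fun R => k R h) atTop (𝓝 (k₀ h)))
    (hf : AEStronglyMeasurable f) (hd : MemLp (diffQuot f) 2) :
    Tendsto (fun R => ∫ z : ℝ × ℝ, k R (z.1 - z.2) * ‖f z.1 - f z.2‖ ^ 2) atTop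
      (𝓝 (∫ z : ℝ × ℝ, k₀ (z.1 - z.2) * ‖f z.1 - f z.2‖ ^ 2)) := by
  refine tendsto_integral_filter_of_dominated_convergence (fun z => c * ‖diffQuot f z‖ ^ 2)
    ?_ ?_ ((integrable_norm_sq_of_memLp_two hd).const_mul c) (.of_forall fun z => ?_)
  · filter_upwards [hk, hkc] with R hR hRc
    exact (integrable_mul_norm_sub_sq hR hRc hf hd).aestronglyMeasurable
  · filter_upwards [hkc] with R hRc
    exact .of_forall (abs_mul_norm_sub_sq_le hRc f)
  · rcases eq_or_ne z.1 z.2 with hz | hz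
    · simp [hz]
    · exact (hlim _ (sub_ne_zero.2 hz)).mul_const _

end KernelBound

variable [InnerProductSpace ℝ E] [CompleteSpace E] {f : ℝ → E} {K : ℝ → ℝ}

theorem inner_deriv_convolution_eq (hK : ContDiff ℝ ∞ K) (hKc : HasCompactSupport K)
    (hf : LocallyIntegrable f) (hf1 : ∀ᵐ x, ‖f x‖ = 1) :
    ∀ᵐ x, inner ℝ (f x) (deriv (K ⋆[lsmul ℝ ℝ] f) x) =
      -(∫ y, deriv K (x - y) * ‖f x - f y‖ ^ 2) / 2 := by
  have hK' : Continuous (deriv K) := hK.continuous_deriv (by simp)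
  filter_upwards [hf1] with x hx
  have h_kernel : Integrable fun y => deriv K (x - y) :=
    (hK'.integrable_of_hasCompactSupport hKc.deriv).comp_sub_left x
  have h_smul := integrable_smul_comp_sub hK' hKc.deriv hf x
  have h_expand : ∀ᵐ y, deriv K (x - y) * ‖f x - f y‖ ^ 2 =
      2 * deriv K (x - y) - 2 * inner ℝ (f x) (deriv K (x - y) • f y) := by
    filter_upwards [hf1] with y hy
    rw [norm_sub_sq_real, real_inner_smul_right, hx, hy]
    ring
  have h_zero : ∫ y, deriv K (x - y) = 0 := by
    rw [integral_sub_left_eq_self (deriv K)]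
    exact integral_deriv_eq_zero_of_hasCompactSupport (hK.of_le (by simp)) hKc
  rw [(hKc.hasDerivAt_convolution_left _ (hK.of_le (by simp)) hf x).deriv,
    convolution_lsmul_swap, integral_congr_ae h_expand,
    integral_sub (h_kernel.const_mul 2) ((h_smul.const_inner (f x)).const_mul 2),
    integral_const_mul, integral_const_mul, h_zero, integral_inner h_smul]
  ring

theorem integrable_inner_deriv_convolution_and_integral_eq (hK : ContDiff ℝ ∞ K)
    (hKc : HasCompactSupport K) (hf : LocallyIntegrable f) (hf1 : ∀ᵐ x, ‖f x‖ = 1)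
    (hd : MemLp (diffQuot f) 2) :
    Integrable (fun x => (inner ℝ (f x) (deriv (K ⋆[lsmul ℝ ℝ] f) x) : ℝ)) ∧
      ∫ x, inner ℝ (f x) (deriv (K ⋆[lsmul ℝ ℝ] f) x) =
        -(∫ z : ℝ × ℝ, deriv K (z.1 - z.2) * ‖f z.1 - f z.2‖ ^ 2) / 2 := by
  have hK' : Continuous (deriv K) := hK.continuous_deriv (by simp)
  obtain ⟨c, hc⟩ := (hKc.deriv.mul_right (f' := fun h => h ^ 2)).exists_bound_of_continuous
    (hK'.mul (continuous_pow 2))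
  have h_int := integrable_mul_norm_sub_sq hK'
    (fun h => by simpa only [Pi.mul_apply, norm_mul, norm_pow, Real.norm_eq_abs, sq_abs] using hc h)
    hf.aestronglyMeasurable hd
  have h_eq := inner_deriv_convolution_eq hK hKc hf hf1
  rw [Measure.volume_eq_prod] at h_int ⊢
  refine ⟨(h_int.integral_prod_left.neg.div_const 2).congr (h_eq.mono fun x hx => hx.symm), ?_⟩
  rw [integral_congr_ae h_eq, integral_div, integral_neg, integral_prod _ h_int]

end KernelEnergy

section Energy

variable {v : ℝ} {Q : ℝ → E3} {K : ℝ → ℝ} {M : ℝ}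

theorem SolvesProfile.abs_integral_kernel_le_of_hasCompactSupport (h : SolvesProfile v Q)
    (hQ : LocallyIntegrable Q) (hQ1 : ∀ᵐ x, ‖Q x‖ = 1) (hd : MemLp (diffQuot Q) 2)
    (hK : ContDiff ℝ ∞ K) (hKc : HasCompactSupport K) (hodd : K.Odd) (hM0 : 0 < M)
    (hM : ∀ ξ, ‖𝓕 (fun t => (K t : ℂ)) ξ‖ ≤ M) :
    2 * Real.pi * |v| * |∫ z : ℝ × ℝ, deriv K (z.1 - z.2) * ‖Q z.1 - Q z.2‖ ^ 2| ≤
      M ^ 2 * (∫ z, ‖diffQuot Q z‖ ^ 2) + ∫ z, ‖wedgeQuot Q z‖ ^ 2 := by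
  have hψ : ContDiff ℝ ∞ (K ⋆[lsmul ℝ ℝ] Q) := hKc.contDiff_convolution_left _ hK hQ
  have hdψ := memLp_diffQuot_convolution hK hKc hM0 hM hQ hd
  obtain ⟨h_int, h_energy⟩ :=
    integrable_inner_deriv_convolution_and_integral_eq hK hKc hQ hQ1 hd
  have h_weak := h.integral_inner_eq_of_memLp hQ.aestronglyMeasurable hQ1 hd hψ
    (memLp_convolution_of_odd hK hKc hodd hQ hd) hdψ h_int
  have h_amgm := abs_integral_inner_le_half hdψ
    (memLp_wedgeQuot hQ.aestronglyMeasurable hQ1 hd)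
  rw [h_weak, h_energy, abs_mul, abs_mul, abs_of_pos Real.two_pi_pos, abs_div, abs_neg,
    abs_two] at h_amgm
  linarith [integral_norm_diffQuot_convolution_sq_le hK hKc hM0 hM hQ hd]

theorem SolvesProfile.abs_integral_kernel_le (h : SolvesProfile v Q)
    (hQ : LocallyIntegrable Q) (hQ1 : ∀ᵐ x, ‖Q x‖ = 1) (hd : MemLp (diffQuot Q) 2)
    (hK : ContDiff ℝ ∞ K) (hKi : Integrable K) (hodd : K.Odd) {c : ℝ}
    (hKc : ∀ h, |K h| * |h| ≤ c) (hKc' : ∀ h, |deriv K h| * h ^ 2 ≤ c) (hM0 : 0 < M)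
    (hM : ∀ ξ, ‖𝓕 (fun t => (K t : ℂ)) ξ‖ ≤ M) :
    2 * Real.pi * |v| * |∫ z : ℝ × ℝ, deriv K (z.1 - z.2) * ‖Q z.1 - Q z.2‖ ^ 2| ≤
      M ^ 2 * (∫ z, ‖diffQuot Q z‖ ^ 2) + ∫ z, ‖wedgeQuot Q z‖ ^ 2 := by
  obtain ⟨c', hc'⟩ :=
    exists_abs_deriv_cutoff_mul_mul_sq_le (hK.differentiable (by simp)) hKc hKc'
  have hsmooth (R : ℝ) : ContDiff ℝ ∞ fun t => cutoff R t * K t := (contDiff_cutoff R).mul hK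
  have h_left := ((tendsto_integral_mul_norm_sub_sq
    (.of_forall fun R => (hsmooth R).continuous_deriv (by simp))
    ((eventually_ge_atTop 1).mono hc') (fun h _ => tendsto_deriv_cutoff_mul K h)
    hQ.aestronglyMeasurable hd).abs.const_mul (2 * Real.pi * |v|))
  have h_right := ((((tendsto_integral_norm_cutoff_sub_one_mul hKi).const_add M).pow 2).mul_const
    (∫ z, ‖diffQuot Q z‖ ^ 2)).add_const (∫ z, ‖wedgeQuot Q z‖ ^ 2)
  rw [add_zero] at h_right
  refine le_of_tendsto_of_tendsto h_left h_right ?_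
  filter_upwards [eventually_ne_atTop 0] with R hR
  exact h.abs_integral_kernel_le_of_hasCompactSupport hQ hQ1 hd (hsmooth R)
    (hasCompactSupport_cutoff hR).mul_right
    (fun t => by rw [cutoff_neg, hodd, mul_neg])
    (add_pos_of_pos_of_nonneg hM0 (integral_nonneg fun t => norm_nonneg _))
    (norm_fourier_cutoff_mul_le hKi hM R)

theorem SolvesProfile.two_mul_abs_mul_energy_le (h : SolvesProfile v Q)
    (hQ : LocallyIntegrable Q) (hQ1 : ∀ᵐ x, ‖Q x‖ = 1) (hd : MemLp (diffQuot Q) 2) :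
    2 * |v| * ∫ z, ‖diffQuot Q z‖ ^ 2 ≤
      (∫ z, ‖diffQuot Q z‖ ^ 2) + ∫ z, ‖wedgeQuot Q z‖ ^ 2 := by
  have h_lim := (tendsto_integral_mul_norm_sub_sq
    ((eventually_gt_atTop 0).mono fun r hr => (contDiff_truncHilbert hr).continuous_deriv (by simp))
    ((eventually_gt_atTop 0).mono fun r hr => abs_deriv_truncHilbert_mul_sq_le hr)
    (fun h hh => tendsto_deriv_truncHilbert hh) hQ.aestronglyMeasurable hd).abs.const_mul
      (2 * Real.pi * |v|)
  have h_limit : ∫ z : ℝ × ℝ, -(Real.pi⁻¹ * ((z.1 - z.2) ^ 2)⁻¹) * ‖Q z.1 - Q z.2‖ ^ 2 =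
      -(Real.pi⁻¹ * ∫ z, ‖diffQuot Q z‖ ^ 2) := by
    rw [← integral_const_mul, ← integral_neg]
    congr 1 with z
    rw [norm_diffQuot_sq, sq_abs]
    ring
  have h_energy : 0 ≤ ∫ z, ‖diffQuot Q z‖ ^ 2 := integral_nonneg fun z => sq_nonneg _
  rw [h_limit, abs_neg, abs_of_nonneg (mul_nonneg (inv_nonneg.2 Real.pi_pos.le) h_energy)] at h_lim
  have h_bound : 2 * Real.pi * |v| * (Real.pi⁻¹ * ∫ z, ‖diffQuot Q z‖ ^ 2) ≤
      1 ^ 2 * (∫ z, ‖diffQuot Q z‖ ^ 2) + ∫ z, ‖wedgeQuot Q z‖ ^ 2 := by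
    refine le_of_tendsto h_lim ((eventually_ge_atTop 1).mono fun r hr => ?_)
    have hr0 : 0 < r := zero_lt_one.trans_le hr
    exact h.abs_integral_kernel_le hQ hQ1 hd (contDiff_truncHilbert hr0)
      (integrable_truncHilbert hr) (truncHilbert_neg r) (abs_truncHilbert_mul_abs_le r)
      (abs_deriv_truncHilbert_mul_sq_le hr0) one_pos (norm_fourier_truncHilbert_le hr)
  have h_pi : 2 * Real.pi * |v| * (Real.pi⁻¹ * ∫ z, ‖diffQuot Q z‖ ^ 2) =
      2 * |v| * ∫ z, ‖diffQuot Q z‖ ^ 2 := by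
    field_simp
  linarith

end Energy

/-! ### Constancy -/

section Constancy

variable {v : ℝ} {Q : ℝ → E3}

theorem ae_eq_of_integral_norm_diffQuot_le (hQ : AEStronglyMeasurable Q)
    (hQ1 : ∀ᵐ x, ‖Q x‖ = 1) (hd : MemLp (diffQuot Q) 2)
    (hle : ∫ z, ‖diffQuot Q z‖ ^ 2 ≤ ∫ z, ‖wedgeQuot Q z‖ ^ 2) :
    ∀ᵐ z : ℝ × ℝ, Q z.1 = Q z.2 := by
  have hd2 := integrable_norm_sq_of_memLp_two hd
  have hw2 := integrable_norm_sq_of_memLp_two (memLp_wedgeQuot hQ hQ1 hd)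
  have h_defect := ae_norm_wedgeQuot_sq_eq hQ1
  have h_nonneg : 0 ≤ᵐ[volume] fun z => ‖diffQuot Q z‖ ^ 2 - ‖wedgeQuot Q z‖ ^ 2 := by
    filter_upwards [h_defect] with z hz
    rw [Pi.zero_apply, hz, sub_sub_cancel]
    positivity
  have h_int : ∫ z, (‖diffQuot Q z‖ ^ 2 - ‖wedgeQuot Q z‖ ^ 2) = 0 := by
    refine le_antisymm ?_ (integral_nonneg_of_ae h_nonneg)
    rw [integral_sub hd2 hw2]
    exact sub_nonpos.2 hle
  filter_upwards [h_defect, (integral_eq_zero_iff_of_nonneg_ae h_nonneg (hd2.sub hw2)).1 h_int]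
    with z hz hz0
  rw [hz, sub_sub_cancel, Pi.zero_apply, div_eq_zero_iff] at hz0
  rcases hz0 with h_eq | h_diag
  · simpa [sub_eq_zero] using h_eq
  · rw [show z.1 = z.2 by simpa [sub_eq_zero] using h_diag]

theorem SolvesProfile.exists_ae_eq_const (h : SolvesProfile v Q) (hv : 1 ≤ |v|)
    (hQ : MemHdotHalfSphere Q) : ∃ p : E3, ‖p‖ = 1 ∧ ∀ᵐ x, Q x = p := by
  obtain ⟨⟨⟨hloc, -⟩, hgag⟩, hQ1⟩ := hQ
  have hd := memLp_diffQuot hloc.aestronglyMeasurable hgag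
  have h_energy := h.two_mul_abs_mul_energy_le hloc hQ1 hd
  have h_nonneg : 0 ≤ ∫ z, ‖diffQuot Q z‖ ^ 2 := integral_nonneg fun z => sq_nonneg _
  have h_le : ∫ z, ‖diffQuot Q z‖ ^ 2 ≤ ∫ z, ‖wedgeQuot Q z‖ ^ 2 := by
    nlinarith [h_nonneg]
  have h_pairs := ae_eq_of_integral_norm_diffQuot_le hloc.aestronglyMeasurable hQ1 hd h_le
  rw [Measure.volume_eq_prod] at h_pairs
  obtain ⟨x, hx, hx1⟩ := ((Measure.ae_ae_of_ae_prod h_pairs).and hQ1).exists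
  exact ⟨Q x, hx1, hx.mono fun y hy => hy.symm⟩

end Constancy

section Constants

variable {Q : ℝ → E3} {p : E3}

theorem gagliardo_eq_zero_of_ae_eq_const {E : Type*} [NormedAddCommGroup E] {f : ℝ → E} {c : E}
    (hf : ∀ᵐ x, f x = c) : gagliardo f = 0 := by
  refine (lintegral_congr_ae ?_).trans lintegral_zero
  filter_upwards [ae_fst_snd_of_ae hf] with z hz
  simp [hz.1, hz.2]

theorem memHdotHalfSphere_of_ae_eq_const (hp : ‖p‖ = 1) (hQ : ∀ᵐ x, Q x = p) :
    MemHdotHalfSphere Q := by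
  have hQ' : (fun _ => p) =ᵐ[volume] Q := hQ.mono fun x hx => hx.symm
  refine ⟨⟨⟨continuous_const.locallyIntegrable.congr hQ', ?_⟩, ?_⟩, hQ.mono fun x hx => hx ▸ hp⟩
  · refine integrable_inv_one_add_sq.congr (hQ.mono fun x hx => ?_)
    simp only [hx, hp, one_div]
  · rw [gagliardo_eq_zero_of_ae_eq_const hQ]
    exact ENNReal.zero_lt_top

theorem wedgeAbsGrad_eq_zero_of_ae_eq_const (hQ : ∀ᵐ x, Q x = p) (φ : ℝ → E3) :
    wedgeAbsGrad Q φ = 0 := by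
  refine mul_eq_zero_of_right _ (integral_eq_zero_of_ae ?_)
  filter_upwards [ae_fst_snd_of_ae hQ] with z hz
  simp [hz.1, hz.2]

theorem distribDeriv_eq_zero_of_ae_eq_const (hQ : ∀ᵐ x, Q x = p) {φ : ℝ → E3}
    (hφ : ContDiff ℝ 1 φ) (hφc : HasCompactSupport φ) : distribDeriv Q φ = 0 := by
  have h_int := (hφ.continuous_deriv le_rfl).integrable_of_hasCompactSupport (μ := volume) hφc.deriv
  have h_const : ∀ᵐ x, inner ℝ (Q x) (deriv φ x) = inner ℝ p (deriv φ x) :=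
    hQ.mono fun x hx => by rw [hx]
  rw [distribDeriv, integral_congr_ae h_const, integral_inner h_int,
    integral_deriv_eq_zero_of_hasCompactSupport hφ hφc, inner_zero_right, neg_zero]

theorem solvesProfile_of_ae_eq_const (v : ℝ) (hQ : ∀ᵐ x, Q x = p) : SolvesProfile v Q := by
  intro φ hφ hφc
  rw [wedgeAbsGrad_eq_zero_of_ae_eq_const hQ,
    distribDeriv_eq_zero_of_ae_eq_const hQ (hφ.of_le (by simp)) hφc, mul_zero, sub_zero]

end Constants

theorem theorem2 (v : ℝ) (hv : 1 ≤ |v|) (Q : ℝ → E3) :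
    (MemHdotHalfSphere Q ∧ SolvesProfile v Q) ↔
      ∃ p : E3, ‖p‖ = 1 ∧ ∀ᵐ x : ℝ, Q x = p := by
  constructor
  · rintro ⟨hQ, h⟩
    exact h.exists_ae_eq_const hv hQ
  · rintro ⟨p, hp, hQ⟩
    exact ⟨memHdotHalfSphere_of_ae_eq_const hp hQ, solvesProfile_of_ae_eq_const v hQ⟩
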